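/- Let $G=(X,Y,E)$ be a finite bipartite graph with positive integer edge weights $w$, and put $w(u,v)=0$ if $u,v$ are not adjacent. A matching is a set of pairwise node-disjoint edges; $\mathrm{mwm}(G)$ is the maximum total weight of a matching of $G$, and $W=\sum_{uv\in E}w(u,v)$. The unfolded graph $\phi(G)$ has, for each node $u$ of $G$, the copies $u^1,\dots,u^{\beta(u)}$, where $\beta(u)$ is the weight of the heaviest edge incident to $u$ ($0$ if there is none), and, for each edge $uv$ of $G$ with weight $b=w(u,v)$, the edges $u^1v^{b},u^2v^{b-1},\dots,u^{b}v^1$. For a matching $M$ of $G$, $\phi(M)$ is the set of the edges of $\phi(G)$ that arise in this way from the edges of $M$. A path in $\phi(G)$ (without repeated nodes) is alternating for $\phi(M)$ if (1) its edges are alternately in and not in $\phi(M)$, and (2) whenever its first (respectively, last) node is matched by $\phi(M)$, the matching edge at that node is the first (respectively, last) edge of the path; so a path of length $0$ is alternating if and only if its node is not matched by $\phi(M)$. The length of a path is its number of edges. For a node $u^i$ of $\phi(G)$ let $\rho(u^i)=0$ if there is an even-length alternating path for $\phi(M)$ starting from $u^i$, and $\rho(u^i)=1$ otherwise. Let $M$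 be a maximum weight matching of $G$. Then: 1. For each node $u$ of $G$, $\displaystyle\sum_{1\le i\le\beta(u)}\rho(u^i)=\mathrm{mwm}(G)-\mathrm{mwm}(G-\{u\})$. 2. Given $G$ and $M$, the values $\rho(u^i)$ for all nodes $u^i$ of $\phi(G)$ can be computed in $O(W)$ time in total, for graphs with $n\ge1$ nodes and $m$ edges where $m=\Omega(n)$. That is, there is one program for a random access machine (elementary operations: constants, moves, addition, truncated subtraction, comparisons, and indirect reading and writing of memory, one step each) such that for every constant $\kappa$ there is a constant $C$ with the following property: for every such $G$ with $1\le n\le\kappa m$, given by a list of its weighted edges in any order, and every maximum weight matching $M$ of $G$, given by marks on the listed edges, the program outputs all the values $\rho(u^i)$ in at most $C\,W$ steps, and no number that it computes exceeds $C\,W$. -/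

import Mathlib

/-- A finite bipartite graph `(X, Y, E)` with positive integer edge weights. As usual `w x y = 0`
means that `x` and `y` are not adjacent, so the edges are the pairs `(x, y)` with `0 < w x y`.
The node set is `X ⊕ Y`. -/
structure WBGraph (X Y : Type*) where
  w : X → Y → ℕ

namespace WBGraph

variable {X Y : Type*}

/-- A matching: a set of edges no two of which share a node. -/
def IsMatching (G : WBGraph X Y) (M : Finset (X × Y)) : Prop :=
  (∀ e ∈ M, 0 < G.w e.1 e.2) ∧
    ∀ e ∈ M, ∀ f ∈ M, e.1 = f.1 ∨ e.2 = f.2 → e = f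

/-- The weight of a set of edges. -/
def weight (G : WBGraph X Y) (M : Finset (X × Y)) : ℕ :=
  ∑ e ∈ M, G.w e.1 e.2

/-- `mwm(G)`, the maximum weight of a matching. -/
noncomputable def mwm (G : WBGraph X Y) : ℕ :=
  sSup {k | ∃ M : Finset (X × Y), G.IsMatching M ∧ G.weight M = k}

/-- `M` is a maximum weight matching of `G`. -/
def IsMaxWeightMatching (G : WBGraph X Y) (M : Finset (X × Y)) : Prop :=
  G.IsMatching M ∧ G.weight M = G.mwm

/-- `G - {u}`: the node `u` and its incident edges are removed. -/
def deleteNode (G : WBGraph X Y) (u : X ⊕ Y) :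
    WBGraph {x : X // Sum.inl x ≠ u} {y : Y // Sum.inr y ≠ u} where
  w x y := G.w x y

variable [Fintype X] [Fintype Y]

/-- The total weight `W` of `G`. -/
def totalWeight (G : WBGraph X Y) : ℕ := ∑ x, ∑ y, G.w x y

/-- The weight of the heaviest edge incident to a node (`0` for an isolated node). -/
def numCopies (G : WBGraph X Y) : X ⊕ Y → ℕ
  | Sum.inl x => Finset.univ.sup fun y => G.w x y
  | Sum.inr y => Finset.univ.sup fun x => G.w x y

/-- The nodes of the unfolded graph: the pair `⟨u, i⟩`, with `i = 0, …, numCopies u - 1`,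
is the copy `u ^ (i + 1)` of `u`. -/
abbrev Copy (G : WBGraph X Y) : Type _ := (u : X ⊕ Y) × Fin (G.numCopies u)

/-- For an edge `xy` in `S` with weight `β`, the copies `x ^ a` and `y ^ b`
with `a + b = β + 1` are joined, that is, `x¹ y^β`, `x² y^(β - 1)`, …, `x^β y¹`. -/
def CrossEdge (G : WBGraph X Y) (S : Set (X × Y)) : G.Copy → G.Copy → Prop
  | ⟨Sum.inl x, i⟩, ⟨Sum.inr y, j⟩ =>
      (x, y) ∈ S ∧ ((i : ℕ) + 1) + ((j : ℕ) + 1) = G.w x y + 1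
  | _, _ => False

/-- The edges of the unfolded graph that arise from the edges in `S`. -/
def unfoldEdges (G : WBGraph X Y) (S : Set (X × Y)) : SimpleGraph G.Copy where
  Adj a b := G.CrossEdge S a b ∨ G.CrossEdge S b a
  symm := ⟨fun _ _ h => h.symm⟩
  loopless := ⟨by rintro ⟨_ | _, _⟩ h <;> simp [CrossEdge] at h⟩

/-- The unfolded graph `φ(G)`. -/
def unfolded (G : WBGraph X Y) : SimpleGraph G.Copy :=
  G.unfoldEdges {e | 0 < G.w e.1 e.2}

/-- `φ(M)`, as the graph on the nodes of `φ(G)` whose edges are those of `φ(M)`. -/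
def unfoldedMatching (G : WBGraph X Y) (M : Finset (X × Y)) : SimpleGraph G.Copy :=
  G.unfoldEdges (M : Set (X × Y))

/-- A path in `φ(G)` (no repeated nodes) is alternating for `φ(M)` if its edges are alternately in
and not in `φ(M)`, and whenever its first (last) node is matched by `φ(M)`, the matching edge at
that node is the first (last) edge of the path. In particular, a path of length zero is alternating
only if its node is unmatched. -/
def IsAlternating (G : WBGraph X Y) (M : Finset (X × Y)) {a b : G.Copy}
    (P : G.unfolded.Walk a b) : Prop :=
  P.IsPath ∧
    P.edges.IsChain (fun e f =>
      e ∈ (G.unfoldedMatching M).edgeSet ↔ f ∉ (G.unfoldedMatching M).edgeSet) ∧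
    (∀ c, (G.unfoldedMatching M).Adj a c → P.edges.head? = some s(a, c)) ∧
    (∀ c, (G.unfoldedMatching M).Adj b c → P.edges.getLast? = some s(b, c))

open Classical in
/-- `ρ(a) = 0` if an even-length alternating path for `φ(M)` starts at `a`, else `ρ(a) = 1`. -/
noncomputable def rho (G : WBGraph X Y) (M : Finset (X × Y)) (a : G.Copy) : ℕ :=
  if ∃ (b : G.Copy) (P : G.unfolded.Walk a b), G.IsAlternating M P ∧ Even P.length then 0 else 1

end WBGraph

/-! A random access machine with step count, programmed in structured form. A program is a fixed
finite text, so it names finitely many registers and finitely many arrays. -/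

namespace RAM

/-- The registers, and the random access memory, which is divided into arrays. -/
structure State where
  reg : ℕ → ℕ
  arr : ℕ → ℕ → ℕ

/-- Overwrite one register. -/
def State.setReg (s : State) (r v : ℕ) : State :=
  { s with reg := Function.update s.reg r v }

/-- Overwrite one memory cell. -/
def State.setArr (s : State) (A i v : ℕ) : State :=
  { s with arr := Function.update s.arr A (Function.update (s.arr A) i v) }

/-- Comparisons of two registers. -/
inductive Test where
  | lt (a b : ℕ)
  | eq (a b : ℕ)

/-- The outcome of a comparison. -/
def Test.Holds (s : State) : Test → Prop
  | .lt a b => s.reg a < s.reg b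
  | .eq a b => s.reg a = s.reg b

/-- Programs. All arguments of type `ℕ` are literals in the program text: names of registers and
arrays, and the constant `k`. -/
inductive Prog where
  | skip
  | const (r k : ℕ)
  | move (r a : ℕ)
  | add (r a b : ℕ)
  | sub (r a b : ℕ)
  | load (r A i : ℕ)
  | store (A i a : ℕ)
  | seq (c d : Prog)
  | ite (t : Test) (c d : Prog)
  | while (t : Test) (c : Prog)

/-- `Exec B c s n s'`: started in state `s`, the program `c` halts after `n` steps in state `s'`,
and no number that it computes exceeds `B` (a computation with a larger number is not an execution;
thus `B` bounds the word size). Every elementary operation and every evaluation of a test is one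
step. `load r A i` reads the cell of the array `A` whose index is in register `i`; `store A i a`
writes to it; `sub` is truncated at `0`. -/
inductive Exec (B : ℕ) : Prog → State → ℕ → State → Prop
  | skip (s : State) : Exec B .skip s 1 s
  | const (s : State) (r k : ℕ) (h : k ≤ B) : Exec B (.const r k) s 1 (s.setReg r k)
  | move (s : State) (r a : ℕ) : Exec B (.move r a) s 1 (s.setReg r (s.reg a))
  | add (s : State) (r a b : ℕ) (h : s.reg a + s.reg b ≤ B) :
      Exec B (.add r a b) s 1 (s.setReg r (s.reg a + s.reg b))
  | sub (s : State) (r a b : ℕ) :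
      Exec B (.sub r a b) s 1 (s.setReg r (s.reg a - s.reg b))
  | load (s : State) (r A i : ℕ) :
      Exec B (.load r A i) s 1 (s.setReg r (s.arr A (s.reg i)))
  | store (s : State) (A i a : ℕ) :
      Exec B (.store A i a) s 1 (s.setArr A (s.reg i) (s.reg a))
  | seq {c d : Prog} {s₁ s₂ s₃ : State} {m n : ℕ} (hc : Exec B c s₁ m s₂)
      (hd : Exec B d s₂ n s₃) : Exec B (.seq c d) s₁ (m + n) s₃
  | ite_true {t : Test} {c d : Prog} {s₁ s₂ : State} {n : ℕ} (ht : t.Holds s₁)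
      (hc : Exec B c s₁ n s₂) : Exec B (.ite t c d) s₁ (n + 1) s₂
  | ite_false {t : Test} {c d : Prog} {s₁ s₂ : State} {n : ℕ} (ht : ¬ t.Holds s₁)
      (hd : Exec B d s₁ n s₂) : Exec B (.ite t c d) s₁ (n + 1) s₂
  | while_true {t : Test} {c : Prog} {s₁ s₂ s₃ : State} {m n : ℕ} (ht : t.Holds s₁)
      (hc : Exec B c s₁ m s₂) (hw : Exec B (.while t c) s₂ n s₃) :
      Exec B (.while t c) s₁ (m + n + 1) s₃
  | while_false {t : Test} {c : Prog} {s : State} (ht : ¬ t.Holds s) :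
      Exec B (.while t c) s 1 s

end RAM

namespace WBGraph

/-- `l` lists the edges of `G`, each once, in some order. -/
def IsEdgeList {X Y : Type*} (G : WBGraph X Y) (l : List (X × Y)) : Prop :=
  l.Nodup ∧ ∀ e, e ∈ l ↔ 0 < G.w e.1 e.2

/-- The initial state for the graph `G` on `p + q` nodes, given by a list `l` of its edges, and the
matching `M`. Registers `0, 1, 2` hold the number of edges and the sizes of the two sides.
Arrays `0, 1, 2, 3` hold, at the index of an edge `xy` in `l`, the nodes `x` and `y`, the
weight of `xy`, and the bit that tells whether `xy` is in `M`. All else is `0`. -/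
def inputState {p q : ℕ} (G : WBGraph (Fin p) (Fin q)) (l : List (Fin p × Fin q))
    (M : Finset (Fin p × Fin q)) : RAM.State where
  reg
    | 0 => l.length
    | 1 => p
    | 2 => q
    | _ => 0
  arr
    | 0 => fun j => (l.map fun e => (e.1 : ℕ)).getD j 0
    | 1 => fun j => (l.map fun e => (e.2 : ℕ)).getD j 0
    | 2 => fun j => (l.map fun e => G.w e.1 e.2).getD j 0
    | 3 => fun j => (l.map fun e => if e ∈ M then 1 else 0).getD j 0
    | _ => fun _ => 0

/-- The state holds all the values `ρ`: array `4` is the concatenation, over the nodes `x` of the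
first side in increasing order, of the lists `ρ(x¹), ρ(x²), …` of the values at all copies of `x`,
and array `5` is the same for the second side. -/
def HoldsRho {p q : ℕ} (G : WBGraph (Fin p) (Fin q)) (M : Finset (Fin p × Fin q))
    (s : RAM.State) : Prop :=
  (∀ (x : Fin p) (i : Fin (G.numCopies (Sum.inl x))),
    s.arr 4 ((∑ x' ∈ Finset.Iio x, G.numCopies (Sum.inl x')) + i) = G.rho M ⟨Sum.inl x, i⟩) ∧
  (∀ (y : Fin q) (j : Fin (G.numCopies (Sum.inr y))),
    s.arr 5 ((∑ y' ∈ Finset.Iio y, G.numCopies (Sum.inr y')) + j) = G.rho M ⟨Sum.inr y, j⟩)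

end WBGraph

set_option linter.unusedSectionVars false

/-! ### Weighted node covers and Egerváry duality -/

namespace WBGraph

section Duality

variable {X Y : Type*}

/-! Everything rests on LP duality in integral form and on reading `ρ` as reachability. Egerváry's
theorem (`exists_cover_sum_eq_mwm`) gives covers `(a, b)` of `G` of total value `mwm(G)`; by
complementary slackness (`IsMaxWeightMatching.tight`) they are tight on `M` and vanish at unmatched
nodes. Since the graph is bipartite, an alternating walk can be cut down to a path, so `ρ(p) = 0`
exactly when `EvenReach` holds, that is, when steps "matching edge, then edge" lead from `p` to an
unmatched copy (`rho_eq_zero_iff`).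

An optimal cover unfolds to a node cover of `φ(G)`, namely the first `a x` copies of each `x` and
the first `b y` of each `y`. All its copies are matched, and it contains just one end of each edge
of `φ(M)`. Following the steps back from an unmatched copy, every copy with `ρ = 0` lies outside it.
So the sum of `ρ` at `u` is at least the value at `u` of any optimal cover, and some optimal cover
has value at least `mwm(G) - mwm(G - u)` there: hang a new edge of just that weight on `u`, which
leaves `mwm` unchanged, and restrict an optimal cover of the larger graph (`exists_cover_marginal`).

For the opposite inequality, the copies with `ρ = 1` on the side of `u`, with the mates of the
copies with `ρ = 0` on that side, form a node cover of `φ(G)` of size at most `mwm(G)`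
(`sideCover`). Counting its copies node by node folds it back to a cover of `G` whose value at `u`
is the sum of `ρ`. Dropping `u` from this cover bounds `mwm(G - u)`.

For the running time, `φ(G)` has at most `2W` copies and exactly `W` edges. It is built as linked
lists of arcs, and a breadth-first search from all unmatched copies, along an edge and then a
matching edge, finds the copies with `ρ = 0`. Each copy enters the queue at most once and each arc
is scanned at most once. The work per listed edge and per node of `G` is also `O(W)`, because
weights are positive and `n ≤ κm`. Correctness and step counts are proved by weakest preconditions
and by potentials that pay for the loops. -/

theorem IsMatching.empty (G : WBGraph X Y) : G.IsMatching ∅ := by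
  simp [IsMatching]

/-- A weighted node cover, the integral dual of a matching. -/
def IsCover (G : WBGraph X Y) (a : X → ℕ) (b : Y → ℕ) : Prop :=
  ∀ x y, G.w x y ≤ a x + b y

/-- The graph with the two sides exchanged. -/
def swap (G : WBGraph X Y) : WBGraph Y X where
  w y x := G.w x y

theorem IsMatching.injOn_fst {G : WBGraph X Y} {M : Finset (X × Y)} (hM : G.IsMatching M) :
    Set.InjOn Prod.fst (M : Set (X × Y)) :=
  fun e he f hf h => hM.2 e he f hf (Or.inl h)

theorem IsMatching.injOn_snd {G : WBGraph X Y} {M : Finset (X × Y)} (hM : G.IsMatching M) :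
    Set.InjOn Prod.snd (M : Set (X × Y)) :=
  fun e he f hf h => hM.2 e he f hf (Or.inr h)

variable [Fintype X] [Fintype Y]

theorem IsMatching.sum_fst_le {G : WBGraph X Y} {M : Finset (X × Y)} (hM : G.IsMatching M)
    (a : X → ℕ) : ∑ e ∈ M, a e.1 ≤ ∑ x, a x := by
  classical
  rw [← Finset.sum_image (f := a) hM.injOn_fst]
  exact Finset.sum_le_sum_of_subset (Finset.subset_univ _)

theorem IsMatching.sum_snd_le {G : WBGraph X Y} {M : Finset (X × Y)} (hM : G.IsMatching M)
    (b : Y → ℕ) : ∑ e ∈ M, b e.2 ≤ ∑ y, b y := by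
  classical
  rw [← Finset.sum_image (f := b) hM.injOn_snd]
  exact Finset.sum_le_sum_of_subset (Finset.subset_univ _)

theorem IsCover.weight_le_sum {G : WBGraph X Y} {a : X → ℕ} {b : Y → ℕ} (h : G.IsCover a b)
    (M : Finset (X × Y)) : G.weight M ≤ ∑ e ∈ M, a e.1 + ∑ e ∈ M, b e.2 := by
  rw [← Finset.sum_add_distrib]
  exact Finset.sum_le_sum fun e _ => h e.1 e.2

theorem IsCover.weight_le {G : WBGraph X Y} {a : X → ℕ} {b : Y → ℕ} (h : G.IsCover a b)
    {M : Finset (X × Y)} (hM : G.IsMatching M) : G.weight M ≤ ∑ x, a x + ∑ y, b y :=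
  (h.weight_le_sum M).trans (add_le_add (hM.sum_fst_le a) (hM.sum_snd_le b))

theorem isCover_sum (G : WBGraph X Y) : G.IsCover (fun x => ∑ y, G.w x y) (fun _ => 0) := by
  intro x y
  exact Finset.single_le_sum (f := fun y => G.w x y) (fun _ _ => Nat.zero_le _) (Finset.mem_univ y)

theorem exists_isMaxWeightMatching (G : WBGraph X Y) :
    ∃ M, G.IsMaxWeightMatching M := by
  have h : G.mwm ∈ {k | ∃ M : Finset (X × Y), G.IsMatching M ∧ G.weight M = k} := by
    refine Nat.sSup_mem ⟨_, ∅, IsMatching.empty G, rfl⟩ ⟨∑ x, ∑ y, G.w x y + ∑ _y : Y, 0, ?_⟩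
    rintro k ⟨M, hM, rfl⟩
    exact G.isCover_sum.weight_le hM
  obtain ⟨M, hM, h⟩ := h
  exact ⟨M, hM, h⟩

theorem IsMatching.weight_le_mwm {G : WBGraph X Y} {M : Finset (X × Y)} (hM : G.IsMatching M) :
    G.weight M ≤ G.mwm := by
  refine le_csSup ⟨∑ x, ∑ y, G.w x y + ∑ _y : Y, 0, ?_⟩ ⟨M, hM, rfl⟩
  rintro k ⟨M, hM, rfl⟩
  exact G.isCover_sum.weight_le hM

theorem IsCover.mwm_le {G : WBGraph X Y} {a : X → ℕ} {b : Y → ℕ} (h : G.IsCover a b) :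
    G.mwm ≤ ∑ x, a x + ∑ y, b y := by
  obtain ⟨M, hM, hw⟩ := G.exists_isMaxWeightMatching
  exact hw ▸ h.weight_le hM

/-- In a cover of least total value, the tight neighbours of a set of nodes of positive value
are at least as many as these nodes. -/
theorem IsCover.card_le_of_tight {G : WBGraph X Y} {a : X → ℕ} {b : Y → ℕ} (h : G.IsCover a b)
    (hmin : ∀ a' b', G.IsCover a' b' → ∑ x, a x + ∑ y, b y ≤ ∑ x, a' x + ∑ y, b' y)
    (P : Finset X) (Q : Finset Y) (hP : ∀ x ∈ P, 0 < a x)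
    (hQ : ∀ x ∈ P, ∀ y, G.w x y = a x + b y → y ∈ Q) : P.card ≤ Q.card := by
  classical
  -- Lowering `a` by one on `P` can break only the tight pairs, since the values are integers;
  -- raising `b` by one on `Q` repairs these. The total changes by `|Q| - |P|`, which minimality
  -- forbids to be negative.
  have hc : G.IsCover (fun x => a x - if x ∈ P then 1 else 0)
      (fun y => b y + if y ∈ Q then 1 else 0) := by
    intro x y
    have h1 := h x y
    by_cases hx : x ∈ P
    · have h2 := hP x hx
      by_cases hy : y ∈ Q
      · simp only [hx, hy, if_true]; omega
      · have h3 : G.w x y ≠ a x + b y := fun h' => hy (hQ x hx y h')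
        simp only [hx, hy, if_true, if_false]; omega
    · simp only [hx, if_false]; omega
  have h1 := hmin _ _ hc
  have h2 : ∑ x, (a x - if x ∈ P then 1 else 0) + P.card = ∑ x, a x := by
    have : P.card = ∑ x, if x ∈ P then 1 else 0 := by simp
    rw [this, ← Finset.sum_add_distrib]
    refine Finset.sum_congr rfl fun x _ => ?_
    by_cases hx : x ∈ P
    · have := hP x hx
      simp only [hx, if_true]; omega
    · simp [hx]
  have h3 : ∑ y, (b y + if y ∈ Q then 1 else 0) = ∑ y, b y + Q.card := by
    rw [Finset.sum_add_distrib]; simp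
  omega

theorem exists_min_cover (G : WBGraph X Y) : ∃ a b, G.IsCover a b ∧
    ∀ a' b', G.IsCover a' b' → ∑ x, a x + ∑ y, b y ≤ ∑ x, a' x + ∑ y, b' y := by
  classical
  have hex : ∃ k, ∃ a b, G.IsCover a b ∧ ∑ x, a x + ∑ y, b y = k := ⟨_, _, _, G.isCover_sum, rfl⟩
  obtain ⟨a, b, h, hk⟩ := Nat.find_spec hex
  exact ⟨a, b, h, fun a' b' h' => hk.trans_le (Nat.find_min' hex ⟨a', b', h', rfl⟩)⟩

/-- **Egerváry's theorem**: some cover has total value `mwm(G)`. -/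
theorem exists_cover_sum_eq_mwm (G : WBGraph X Y) :
    ∃ a b, G.IsCover a b ∧ ∑ x, a x + ∑ y, b y = G.mwm := by
  classical
  obtain ⟨a, b, h, hmin⟩ := G.exists_min_cover
  refine ⟨a, b, h, le_antisymm ?_ h.mwm_le⟩
  -- Both sides are padded with dummies of value and weight `0` to the common size `|X| + |Y|`. A
  -- perfect matching by tight pairs, supplied by Hall's theorem, then has the total value of the
  -- cover as its weight.
  let A : X ⊕ Y → ℕ := Sum.elim a fun _ => 0
  let B : Y ⊕ X → ℕ := Sum.elim b fun _ => 0
  let v : X ⊕ Y → Y ⊕ X → ℕ := Sum.elim (fun x => Sum.elim (G.w x) fun _ => 0) fun _ _ => 0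
  let t : X ⊕ Y → Finset (Y ⊕ X) := fun l => Finset.univ.filter fun r => A l + B r = v l r
  have hall : ∀ S : Finset (X ⊕ Y), S.card ≤ (S.biUnion t).card := by
    intro S
    have hS := S.card_toLeft_add_card_toRight
    have hN := (S.biUnion t).card_toLeft_add_card_toRight
    have memL : ∀ y, y ∈ (S.biUnion t).toLeft ↔
        (∃ x, Sum.inl x ∈ S ∧ a x + b y = G.w x y) ∨ ∃ y', Sum.inr y' ∈ S ∧ b y = 0 := by
      intro y; simp [t, A, B, v]
    have memR : ∀ x, x ∈ (S.biUnion t).toRight ↔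
        (∃ x', Sum.inl x' ∈ S ∧ a x' = 0) ∨ ∃ y', Sum.inr y' ∈ S := by
      intro x; simp [t, A, B, v]
    have full : (S.biUnion t).toRight = Finset.univ → Fintype.card X ≤ (S.biUnion t).toRight.card :=
      fun h => by rw [h]; rfl
    -- Without dummies in `S`, either a node of value `0` is tight with all dummies `X` on the
    -- right, or `card_le_of_tight` applies directly. A dummy in `S` is tight with all of these
    -- dummies and with every `y` of value `0`; so the `y` that are missed have positive value, and
    -- the swapped lemma applies to them.
    rcases S.toRight.eq_empty_or_nonempty with hY | ⟨y', hy'⟩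
    · rw [hY] at hS
      by_cases hz : ∃ x', Sum.inl x' ∈ S ∧ a x' = 0
      · have := full (Finset.eq_univ_iff_forall.2 fun x => (memR x).2 (Or.inl hz))
        have := S.toLeft.card_le_univ
        simp at hS
        omega
      · push Not at hz
        have := h.card_le_of_tight hmin S.toLeft (S.biUnion t).toLeft
          (fun x hx => Nat.pos_of_ne_zero (hz x (by simpa using hx)))
          (fun x hx y hxy => (memL y).2 (Or.inl ⟨x, by simpa using hx, hxy.symm⟩))
        simp at hS
        omega
    · have hy : Sum.inr y' ∈ S := by simpa using hy'
      have h1 := full (Finset.eq_univ_iff_forall.2 fun x => (memR x).2 (Or.inr ⟨y', hy⟩))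
      have hs : G.swap.IsCover b a := fun y x => (h x y).trans (add_comm _ _).le
      have h2 := hs.card_le_of_tight (fun b' a' h' => by
          have := hmin a' b' fun x y => (h' y x).trans (add_comm _ _).le
          omega) (S.biUnion t).toLeftᶜ S.toLeftᶜ
        (fun y hyn => Nat.pos_of_ne_zero fun h0 =>
          (Finset.mem_compl.1 hyn) ((memL y).2 (Or.inr ⟨y', hy, h0⟩)))
        (fun y hyn x hxy => Finset.mem_compl.2 fun hx =>
          (Finset.mem_compl.1 hyn) ((memL y).2 (Or.inl ⟨x, by simpa using hx, by
            rw [add_comm]; exact hxy.symm⟩)))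
      rw [Finset.card_compl, Finset.card_compl] at h2
      have := S.toLeft.card_le_univ
      have := S.toRight.card_le_univ
      have := (S.biUnion t).toLeft.card_le_univ
      omega
  obtain ⟨f, hf, hft⟩ := (Finset.all_card_le_biUnion_card_iff_exists_injective t).1 hall
  have hbij : Function.Bijective f :=
    (Fintype.bijective_iff_injective_and_card f).2 ⟨hf, by simp [add_comm]⟩
  have htight : ∀ l, A l + B (f l) = v l (f l) := fun l => by simpa [t] using hft l
  have hsum : ∑ l, A l + ∑ r, B r = ∑ l, v l (f l) := by
    rw [← hbij.sum_comp B, ← Finset.sum_add_distrib]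
    exact Finset.sum_congr rfl fun l _ => htight l
  -- Discarding dummies and pairs of weight `0` from the perfect matching loses no weight.
  let M : Finset (X × Y) :=
    Finset.univ.filter fun e => f (Sum.inl e.1) = Sum.inl e.2 ∧ 0 < G.w e.1 e.2
  have hM : G.IsMatching M := by
    refine ⟨fun e he => (Finset.mem_filter.1 he).2.2, ?_⟩
    rintro ⟨x, y⟩ he ⟨x', y'⟩ he' h'
    have h1 := (Finset.mem_filter.1 he).2.1
    have h2 := (Finset.mem_filter.1 he').2.1
    simp only at h1 h2 h'
    rcases h' with rfl | rfl
    · rw [h1] at h2; simp_all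
    · rw [← h2] at h1; have := hf h1; simp_all
  have hw : ∑ l, v l (f l) = G.weight M := by
    rw [Fintype.sum_sum_type]
    simp only [v, Sum.elim_inl, Sum.elim_inr, Finset.sum_const_zero, add_zero]
    rw [weight, Finset.sum_filter, Fintype.sum_prod_type]
    refine Finset.sum_congr rfl fun x _ => ?_
    rcases hx : f (Sum.inl x) with y | x'
    · rw [Finset.sum_eq_single y]
      · simp [hx]
      · intro y' _ hne; simp [hx, hne.symm]
      · simp
    · simp [hx]
  have : ∑ x, a x + ∑ y, b y = ∑ l, A l + ∑ r, B r := by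
    simp [A, B, Fintype.sum_sum_type]
  rw [this, hsum, hw]
  exact hM.weight_le_mwm

/-- Complementary slackness. -/
theorem IsMaxWeightMatching.tight {G : WBGraph X Y} {M : Finset (X × Y)}
    (hM : G.IsMaxWeightMatching M) {a : X → ℕ} {b : Y → ℕ} (h : G.IsCover a b)
    (hs : ∑ x, a x + ∑ y, b y = G.mwm) :
    (∀ e ∈ M, G.w e.1 e.2 = a e.1 + b e.2) ∧ (∀ x, 0 < a x → ∃ y, (x, y) ∈ M) ∧
      ∀ y, 0 < b y → ∃ x, (x, y) ∈ M := by
  classical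
  have h1 := h.weight_le_sum M
  have h2 := hM.1.sum_fst_le a
  have h3 := hM.1.sum_snd_le b
  have h4 := hM.2
  refine ⟨?_, ?_, ?_⟩
  · refine (Finset.sum_eq_sum_iff_of_le fun e _ => h e.1 e.2).1 ?_
    rw [Finset.sum_add_distrib]
    unfold weight at h1 h4
    omega
  · intro x hx
    have h5 : ∑ x ∈ M.image Prod.fst, a x = ∑ x, a x := by
      rw [Finset.sum_image hM.1.injOn_fst]; omega
    by_contra hn
    push Not at hn
    have := Finset.sum_lt_sum_of_subset (f := a) (Finset.subset_univ (M.image Prod.fst))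
      (Finset.mem_univ x) (by simpa using hn) hx fun _ _ _ => Nat.zero_le _
    omega
  · intro y hy
    have h5 : ∑ y ∈ M.image Prod.snd, b y = ∑ y, b y := by
      rw [Finset.sum_image hM.1.injOn_snd]; omega
    by_contra hn
    push Not at hn
    have := Finset.sum_lt_sum_of_subset (f := b) (Finset.subset_univ (M.image Prod.snd))
      (Finset.mem_univ y) (by simpa using hn) hy fun _ _ _ => Nat.zero_le _
    omega

end Duality

end WBGraph

/-! ### Alternating paths as reachability -/

namespace SimpleGraph

variable {V : Type*} (H N : SimpleGraph V)

/-- The nodes from which an unmatched node is reached by steps along a matching edge and a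
further edge. -/
inductive EvenReach : V → Prop
  | base {a : V} (h : ∀ b, ¬N.Adj a b) : EvenReach a
  | step {a b c : V} (hab : N.Adj a b) (hbc : H.Adj b c) (hc : EvenReach c) : EvenReach a

variable {H}

/-- Walks of even length, alternately along edges of `N` and other edges, starting with an edge
of `N`, that end at an unmatched node. -/
inductive EvenAltWalk : ∀ {a b : V}, H.Walk a b → Prop
  | nil {a : V} (h : ∀ b, ¬N.Adj a b) : EvenAltWalk (Walk.nil : H.Walk a a)
  | cons {a b c d : V} (hN : N.Adj a b) (hab : H.Adj a b) (hbc : H.Adj b c) (hn : ¬N.Adj b c)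
      {P : H.Walk c d} (hP : EvenAltWalk P) : EvenAltWalk (Walk.cons hab (Walk.cons hbc P))

variable {N}

theorem EvenAltWalk.even {a b : V} {P : H.Walk a b} (h : EvenAltWalk N P) : Even P.length := by
  induction h with
  | nil => simp
  | cons _ _ _ _ _ ih => simpa [add_assoc, Nat.even_add] using ih

theorem EvenAltWalk.not_adj_end {a b : V} {P : H.Walk a b} (h : EvenAltWalk N P) (c : V) :
    ¬N.Adj b c := by
  induction h with
  | nil h => exact h c
  | cons _ _ _ _ _ ih => exact ih

theorem EvenAltWalk.isChain {a b : V} {P : H.Walk a b} (h : EvenAltWalk N P) :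
    P.edges.IsChain (fun e f => e ∈ N.edgeSet ↔ f ∉ N.edgeSet) := by
  induction h with
  | nil => simp
  | cons hN hab hbc hn hP ih =>
    cases hP with
    | nil => simpa [hN] using hn
    | cons hN' _ _ _ hP' =>
      simp only [Walk.edges_cons, List.isChain_cons_cons, mem_edgeSet, hN, hn, hN', not_true_eq_false,
        not_false_eq_true, true_and] at ih ⊢
      exact ih

theorem EvenAltWalk.head {a b : V} {P : H.Walk a b} (h : EvenAltWalk N P)
    (huniq : ∀ a b c, N.Adj a b → N.Adj a c → b = c) (c : V) (hc : N.Adj a c) :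
    P.edges.head? = some s(a, c) := by
  cases h with
  | nil h => exact absurd hc (h c)
  | cons hN hab hbc hn hP => simp [huniq _ _ _ hN hc]

/-- The suffix of an alternating path that starts at a node on the side of its first node. -/
theorem EvenAltWalk.exists_suffix {a b : V} {P : H.Walk a b} (h : EvenAltWalk N P)
    (col : V → Bool) (hcol : ∀ a b, H.Adj a b → col a ≠ col b) (hp : P.IsPath) {x : V}
    (hx : x ∈ P.support) (hxa : col x = col a) :
    ∃ Q : H.Walk x b, Q.IsPath ∧ EvenAltWalk N Q := by
  induction h with
  | nil h =>
    simp only [Walk.support_nil, List.mem_singleton] at hx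
    subst hx
    exact ⟨Walk.nil, by simp, .nil h⟩
  | cons hN hab hbc hn hP ih =>
    simp only [Walk.support_cons, List.mem_cons] at hx
    rcases hx with rfl | rfl | hx
    · exact ⟨_, hp, .cons hN hab hbc hn hP⟩
    · exact absurd hxa.symm (hcol _ _ hab)
    · refine ih ((Walk.cons_isPath_iff _ _).1 ((Walk.cons_isPath_iff _ _).1 hp).1).1 hx ?_
      have h1 := hcol _ _ hab
      have h2 := hcol _ _ hbc
      revert h1 h2 hxa
      generalize col x = p
      cases p <;> cases col _ <;> cases col _ <;> cases col _ <;> simp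

/-- Nodes of the colour opposite to the start sit at odd positions, where they are entered along
their matching edge. -/
theorem EvenAltWalk.mate_mem {a b : V} {P : H.Walk a b} (h : EvenAltWalk N P)
    (col : V → Bool) (hcol : ∀ a b, H.Adj a b → col a ≠ col b)
    (huniq : ∀ a b c, N.Adj a b → N.Adj a c → b = c) {x y : V}
    (hx : x ∈ P.support) (hxa : col x ≠ col a) (hxy : N.Adj x y) : y ∈ P.support := by
  induction h with
  | nil h =>
    simp only [Walk.support_nil, List.mem_singleton] at hx
    exact absurd (congrArg col hx) hxa
  | cons hN hab hbc hn hP ih =>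
    simp only [Walk.support_cons, List.mem_cons] at hx ⊢
    rcases hx with rfl | rfl | hx
    · exact absurd rfl hxa
    · exact Or.inl (huniq _ _ _ hxy hN.symm)
    · refine Or.inr (Or.inr (ih hx ?_))
      have h1 := hcol _ _ hab
      have h2 := hcol _ _ hbc
      revert h1 h2 hxa
      generalize col x = p
      cases p <;> cases col _ <;> cases col _ <;> cases col _ <;> simp

theorem EvenReach.exists_path (hNH : N ≤ H) (col : V → Bool)
    (hcol : ∀ a b, H.Adj a b → col a ≠ col b)
    (huniq : ∀ a b c, N.Adj a b → N.Adj a c → b = c) {a : V} (h : EvenReach H N a) :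
    ∃ (b : V) (P : H.Walk a b), P.IsPath ∧ EvenAltWalk N P := by
  induction h with
  | base h => exact ⟨_, Walk.nil, by simp, .nil h⟩
  | @step a b c hab hbc hc ih =>
    obtain ⟨d, P, hP, hA⟩ := ih
    have hcola : col a = col c := by
      have h1 := hcol _ _ (hNH hab)
      have h2 := hcol _ _ hbc
      revert h1 h2
      cases col a <;> cases col b <;> cases col c <;> simp
    -- If `a` is already on the path, no new edges are needed: it has the colour of the start, so
    -- the suffix from `a` is again alternating.
    by_cases ha : a ∈ P.support
    · obtain ⟨Q, hQ⟩ := hA.exists_suffix col hcol hP ha hcola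
      exact ⟨d, Q, hQ⟩
    · have hn : ¬N.Adj b c := by
        intro h
        obtain rfl := huniq _ _ _ hab.symm h
        exact ha P.start_mem_support
      -- If `b` were on the path, at an odd position, its mate `a` would be too.
      have hb : b ∉ P.support := fun hb =>
        ha (hA.mate_mem col hcol huniq hb (fun h => hcol _ _ hbc h) hab.symm)
      refine ⟨d, _, ?_, .cons hab (hNH hab) hbc hn hA⟩
      rw [Walk.cons_isPath_iff, Walk.cons_isPath_iff]
      refine ⟨⟨hP, hb⟩, ?_⟩
      simp only [Walk.support_cons, List.mem_cons, not_or]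
      exact ⟨(hNH hab).ne, ha⟩

/-- Peel off two edges at a time. A matched first node forces the first edge into `N`, so
alternation puts the second one outside, and the rest of the walk satisfies the same end conditions.
-/
theorem evenReach_of_walk (huniq : ∀ a b c, N.Adj a b → N.Adj a c → b = c) (n : ℕ) :
    ∀ {a b : V} (P : H.Walk a b), P.length = 2 * n →
      P.edges.IsChain (fun e f => e ∈ N.edgeSet ↔ f ∉ N.edgeSet) →
      (∀ c, N.Adj a c → P.edges.head? = some s(a, c)) →
      (∀ c, N.Adj b c → P.edges.getLast? = some s(b, c)) → EvenReach H N a := by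
  induction n with
  | zero =>
    intro a b P hl _ hh _
    cases P with
    | nil => exact .base fun c hc => by simpa using hh c hc
    | cons h P => simp at hl
  | succ n ih =>
    intro a b P hl hch hh hlast
    by_cases hm : ∃ c, N.Adj a c
    swap
    · push Not at hm
      exact .base hm
    obtain ⟨v, hv⟩ := hm
    cases P with
    | nil => simp at hl
    | @cons _ v' _ hav P =>
    have hvv : v' = v := by
      have := hh v hv
      simp only [Walk.edges_cons, List.head?_cons, Option.some.injEq, Sym2.congr_right] at this
      exact this
    subst hvv
    cases P with
    | nil => simp at hl; omega
    | @cons _ w _ hvw P =>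
    simp only [Walk.edges_cons, List.isChain_cons_cons, mem_edgeSet, hv, true_iff] at hch
    refine .step hv hvw (ih P (by simp at hl; omega) hch.2.of_cons ?_ ?_)
    · intro c hc
      -- If nothing remains, `w` is also the last node, and a mate of `w` would put the edge just
      -- peeled off into `N`. Otherwise alternation makes the next edge the matching edge at `w`.
      cases P with
      | nil =>
        have := hlast c hc
        simp only [Walk.edges_cons, Walk.edges_nil, List.getLast?_cons_cons, List.getLast?_singleton,
          Option.some.injEq] at this
        have h1 := (mem_edgeSet N).2 hc
        rw [← this] at h1
        exact absurd h1 hch.1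
      | @cons _ z _ hwz P =>
        simp only [Walk.edges_cons, List.isChain_cons_cons] at hch
        have h1 : N.Adj w z := by
          have := hch.2.1
          simp only [mem_edgeSet] at this hch
          tauto
        simp [huniq _ _ _ h1 hc]
    · intro c hc
      have := hlast c hc
      cases P with
      | nil =>
        simp only [Walk.edges_cons, Walk.edges_nil, List.getLast?_cons_cons, List.getLast?_singleton,
          Option.some.injEq] at this
        have h1 := (mem_edgeSet N).2 hc
        rw [← this] at h1
        exact absurd h1 hch.1
      | cons hwz P => simpa using this

end SimpleGraph

/-! ### Matching edges of the unfolded graph, and `ρ` as reachability -/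

namespace WBGraph

variable {X Y : Type*} [Fintype X] [Fintype Y] {G : WBGraph X Y} {M : Finset (X × Y)}

theorem unfoldEdges_side {S : Set (X × Y)} {p q : G.Copy} (h : (G.unfoldEdges S).Adj p q) :
    p.1.isLeft ≠ q.1.isLeft := by
  rcases p with ⟨_ | _, _⟩ <;> rcases q with ⟨_ | _, _⟩ <;>
    simp [unfoldEdges, CrossEdge] at h ⊢

theorem unfoldEdges_adj_inl {S : Set (X × Y)} {x : X} {y : Y} {i : Fin (G.numCopies (.inl x))}
    {j : Fin (G.numCopies (.inr y))} : (G.unfoldEdges S).Adj ⟨.inl x, i⟩ ⟨.inr y, j⟩ ↔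
      (x, y) ∈ S ∧ (i : ℕ) + j + 1 = G.w x y := by
  simp only [unfoldEdges, CrossEdge, or_false]
  constructor <;> rintro ⟨h, h'⟩ <;> exact ⟨h, by omega⟩

theorem unfoldEdges_adj_inr {S : Set (X × Y)} {x : X} {y : Y} {i : Fin (G.numCopies (.inl x))}
    {j : Fin (G.numCopies (.inr y))} : (G.unfoldEdges S).Adj ⟨.inr y, j⟩ ⟨.inl x, i⟩ ↔
      (x, y) ∈ S ∧ (i : ℕ) + j + 1 = G.w x y := by
  rw [SimpleGraph.adj_comm, unfoldEdges_adj_inl]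

theorem IsMatching.unfoldedMatching_le (hM : G.IsMatching M) :
    G.unfoldedMatching M ≤ G.unfolded := by
  intro p q h
  rcases p with ⟨x | y, i⟩ <;> rcases q with ⟨x' | y', j⟩
  · exact (unfoldEdges_side h rfl).elim
  · obtain ⟨h1, h2⟩ := unfoldEdges_adj_inl.1 h
    exact unfoldEdges_adj_inl.2 ⟨hM.1 _ h1, h2⟩
  · obtain ⟨h1, h2⟩ := unfoldEdges_adj_inr.1 h
    exact unfoldEdges_adj_inr.2 ⟨hM.1 _ h1, h2⟩
  · exact (unfoldEdges_side h rfl).elim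

theorem IsMatching.unfoldedMatching_unique (hM : G.IsMatching M) {p q r : G.Copy}
    (hq : (G.unfoldedMatching M).Adj p q) (hr : (G.unfoldedMatching M).Adj p r) : q = r := by
  rcases p with ⟨x | y, i⟩ <;> rcases q with ⟨x' | y', j⟩ <;> rcases r with ⟨x'' | y'', k⟩
  all_goals first
    | exact (unfoldEdges_side hq rfl).elim
    | exact (unfoldEdges_side hr rfl).elim
    | skip
  · obtain ⟨h1, h2⟩ := unfoldEdges_adj_inl.1 hq
    obtain ⟨h3, h4⟩ := unfoldEdges_adj_inl.1 hr
    have h5 := hM.2 _ h1 _ h3 (Or.inl rfl)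
    simp only [Prod.mk.injEq, true_and] at h5
    subst h5
    congr 1
    exact Fin.ext (by omega)
  · obtain ⟨h1, h2⟩ := unfoldEdges_adj_inr.1 hq
    obtain ⟨h3, h4⟩ := unfoldEdges_adj_inr.1 hr
    have h5 := hM.2 _ h1 _ h3 (Or.inr rfl)
    simp only [Prod.mk.injEq, and_true] at h5
    subst h5
    congr 1
    exact Fin.ext (by omega)

theorem IsMatching.rho_eq_zero_iff (hM : G.IsMatching M) (p : G.Copy) :
    G.rho M p = 0 ↔ SimpleGraph.EvenReach G.unfolded (G.unfoldedMatching M) p := by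
  have huniq : ∀ a b c, (G.unfoldedMatching M).Adj a b → (G.unfoldedMatching M).Adj a c → b = c :=
    fun _ _ _ => hM.unfoldedMatching_unique
  classical
  have hrho : G.rho M p = 0 ↔
      ∃ (b : G.Copy) (P : G.unfolded.Walk p b), G.IsAlternating M P ∧ Even P.length := by
    unfold rho
    split_ifs with h <;> simp [h]
  rw [hrho]
  constructor
  · rintro ⟨b, P, ⟨_, hch, hh, hl⟩, n, hn⟩
    exact SimpleGraph.evenReach_of_walk huniq n P (by omega) hch hh hl
  · intro h
    obtain ⟨b, P, hP, hA⟩ := h.exists_path hM.unfoldedMatching_le (fun p => p.1.isLeft)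
      (fun _ _ => unfoldEdges_side) huniq
    exact ⟨b, P, ⟨hP, hA.isChain, hA.head huniq, fun c hc => absurd hc (hA.not_adj_end c)⟩, hA.even⟩

theorem rho_eq_one_of_ne_zero {p : G.Copy} (h : G.rho M p ≠ 0) : G.rho M p = 1 := by
  unfold rho at h ⊢
  split_ifs at h ⊢ with h1
  · exact absurd rfl h
  · rfl

end WBGraph

/-! ### Node covers of the unfolded graph and the marginal value of a node -/

namespace WBGraph

section Marginal

open SimpleGraph

variable {X Y : Type*} [Fintype X] [Fintype Y] {G : WBGraph X Y} {M : Finset (X × Y)}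
  {a : X → ℕ} {b : Y → ℕ}

theorem w_le_numCopies_inl (G : WBGraph X Y) (x : X) (y : Y) :
    G.w x y ≤ G.numCopies (.inl x) :=
  Finset.le_sup (f := fun y => G.w x y) (Finset.mem_univ y)

theorem w_le_numCopies_inr (G : WBGraph X Y) (x : X) (y : Y) :
    G.w x y ≤ G.numCopies (.inr y) :=
  Finset.le_sup (f := fun x => G.w x y) (Finset.mem_univ x)

/-- The copies selected by a cover of `G`: the first `a x` of `x` and the first `b y` of `y`. -/
def coverCopies (G : WBGraph X Y) (a : X → ℕ) (b : Y → ℕ) : Set G.Copy :=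
  {p | (p.2 : ℕ) < Sum.elim a b p.1}

/-- With indices from `0`, adjacency says `i + j + 1 = w x y ≤ a x + b y`, which excludes `i ≥ a x`
together with `j ≥ b y`. -/
theorem IsCover.mem_coverCopies (h : G.IsCover a b) {p q : G.Copy} (hpq : G.unfolded.Adj p q) :
    p ∈ G.coverCopies a b ∨ q ∈ G.coverCopies a b := by
  rcases p with ⟨x | y, i⟩ <;> rcases q with ⟨x' | y', j⟩
  · exact (unfoldEdges_side hpq rfl).elim
  · have h1 := (unfoldEdges_adj_inl.1 hpq).2
    have h2 := h x y'
    simp only [coverCopies, Set.mem_ofPred_eq, Sum.elim_inl, Sum.elim_inr]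
    omega
  · have h1 := (unfoldEdges_adj_inr.1 hpq).2
    have h2 := h x' y
    simp only [coverCopies, Set.mem_ofPred_eq, Sum.elim_inl, Sum.elim_inr]
    omega
  · exact (unfoldEdges_side hpq rfl).elim

theorem IsMaxWeightMatching.exists_adj_of_mem_coverCopies (hM : G.IsMaxWeightMatching M)
    (h : G.IsCover a b) (hs : ∑ x, a x + ∑ y, b y = G.mwm) {p : G.Copy}
    (hp : p ∈ G.coverCopies a b) : ∃ q, (G.unfoldedMatching M).Adj p q := by
  obtain ⟨h1, h2, h3⟩ := hM.tight h hs
  rcases p with ⟨x | y, i⟩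
  · simp only [coverCopies, Set.mem_ofPred_eq, Sum.elim_inl] at hp
    obtain ⟨y, hy⟩ := h2 x (by omega)
    have h4 := h1 _ hy
    have h5 := G.w_le_numCopies_inr x y
    simp only at h4
    -- The partner of copy `i` has index `w - 1 - i`, no truncation occurring because `i < a x ≤ w`
    -- by tightness.
    exact ⟨⟨.inr y, ⟨G.w x y - 1 - i, by omega⟩⟩, unfoldEdges_adj_inl.2 ⟨hy, by simp only; omega⟩⟩
  · simp only [coverCopies, Set.mem_ofPred_eq, Sum.elim_inr] at hp
    obtain ⟨x, hx⟩ := h3 y (by omega)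
    have h4 := h1 _ hx
    have h5 := G.w_le_numCopies_inl x y
    simp only at h4
    exact ⟨⟨.inl x, ⟨G.w x y - 1 - i, by omega⟩⟩, unfoldEdges_adj_inr.2 ⟨hx, by simp only; omega⟩⟩

/-- On edges of `M` the cover is tight, so `i + j + 1 = a x + b y`, and `i < a x` gives `j ≥ b y`.
-/
theorem IsMaxWeightMatching.notMem_coverCopies (hM : G.IsMaxWeightMatching M)
    (h : G.IsCover a b) (hs : ∑ x, a x + ∑ y, b y = G.mwm) {p q : G.Copy}
    (hpq : (G.unfoldedMatching M).Adj p q) (hp : p ∈ G.coverCopies a b) :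
    q ∉ G.coverCopies a b := by
  obtain ⟨h1, -, -⟩ := hM.tight h hs
  rcases p with ⟨x | y, i⟩ <;> rcases q with ⟨x' | y', j⟩
  · exact (unfoldEdges_side hpq rfl).elim
  · obtain ⟨h2, h3⟩ := unfoldEdges_adj_inl.1 hpq
    have h2 := h1 _ h2
    simp only [coverCopies, Set.mem_ofPred_eq, Sum.elim_inl, Sum.elim_inr] at h2 hp ⊢
    omega
  · obtain ⟨h2, h3⟩ := unfoldEdges_adj_inr.1 hpq
    have h2 := h1 _ h2
    simp only [coverCopies, Set.mem_ofPred_eq, Sum.elim_inl, Sum.elim_inr] at h2 hp ⊢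
    omega
  · exact (unfoldEdges_side hpq rfl).elim

/-- Unmatched copies are outside the cover. If `c` is outside, its neighbour `b` is inside, and then
the mate of `b` is outside. -/
theorem IsMaxWeightMatching.notMem_coverCopies_of_evenReach (hM : G.IsMaxWeightMatching M)
    (h : G.IsCover a b) (hs : ∑ x, a x + ∑ y, b y = G.mwm) {p : G.Copy}
    (hp : EvenReach G.unfolded (G.unfoldedMatching M) p) : p ∉ G.coverCopies a b := by
  induction hp with
  | base hn =>
    intro hp
    obtain ⟨q, hq⟩ := hM.exists_adj_of_mem_coverCopies h hs hp
    exact hn q hq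
  | step hab hbc _ ih =>
    have := (h.mem_coverCopies hbc).resolve_right ih
    exact hM.notMem_coverCopies h hs hab.symm this

/-- The largest minimum node cover of `φ(G)` on the side `s`. -/
def sideCover (G : WBGraph X Y) (M : Finset (X × Y)) (s : Bool) : Set G.Copy :=
  {p | (p.1.isLeft = s ∧ ¬EvenReach G.unfolded (G.unfoldedMatching M) p) ∨
    (p.1.isLeft ≠ s ∧ ∃ q, (G.unfoldedMatching M).Adj p q ∧
      EvenReach G.unfolded (G.unfoldedMatching M) q)}

theorem IsMaxWeightMatching.mem_sideCover (hM : G.IsMaxWeightMatching M) (s : Bool)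
    {p q : G.Copy} (hpq : G.unfolded.Adj p q) : p ∈ G.sideCover M s ∨ q ∈ G.sideCover M s := by
  wlog hp : p.1.isLeft = s generalizing p q
  · refine (this hpq.symm ?_).symm
    have := unfoldEdges_side hpq
    revert this hp
    cases p.1.isLeft <;> cases q.1.isLeft <;> cases s <;> simp
  by_cases hr : EvenReach G.unfolded (G.unfoldedMatching M) p
  · refine Or.inr (Or.inr ⟨fun h => unfoldEdges_side hpq (hp.trans h.symm), ?_⟩)
    by_cases hq : ∃ r, (G.unfoldedMatching M).Adj q r
    · obtain ⟨r, hr'⟩ := hq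
      exact ⟨r, hr', .step hr'.symm hpq.symm hr⟩
    -- An unmatched `q` next to a reachable `p` would give an augmenting path. Here both would avoid
    -- the node cover that comes from an optimal cover, although they are adjacent.
    · push Not at hq
      obtain ⟨a, b, h, hs⟩ := G.exists_cover_sum_eq_mwm
      rcases h.mem_coverCopies hpq with h1 | h1
      · exact absurd h1 (hM.notMem_coverCopies_of_evenReach h hs hr)
      · exact absurd h1 (hM.notMem_coverCopies_of_evenReach h hs (.base hq))
  · exact Or.inl (Or.inl ⟨hp, hr⟩)

theorem exists_adj_of_mem_sideCover {s : Bool} {p : G.Copy} (hp : p ∈ G.sideCover M s) :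
    ∃ q, (G.unfoldedMatching M).Adj p q := by
  rcases hp with ⟨_, h⟩ | ⟨_, q, hq, _⟩
  · by_contra hn
    push Not at hn
    exact h (.base hn)
  · exact ⟨q, hq⟩

theorem IsMatching.notMem_sideCover (hM : G.IsMatching M) {s : Bool} {p q : G.Copy}
    (hpq : (G.unfoldedMatching M).Adj p q) (hp : p ∈ G.sideCover M s) : q ∉ G.sideCover M s := by
  have hside : p.1.isLeft ≠ q.1.isLeft := unfoldEdges_side hpq
  rintro (⟨h1, h2⟩ | ⟨h1, r, h2, h3⟩) <;> rcases hp with ⟨h4, h5⟩ | ⟨h4, r', h5, h6⟩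
  · exact hside (h4.trans h1.symm)
  · exact h2 (hM.unfoldedMatching_unique hpq h5 ▸ h6)
  · exact h5 (hM.unfoldedMatching_unique hpq.symm h2 ▸ h3)
  · revert hside h1 h4
    cases p.1.isLeft <;> cases q.1.isLeft <;> cases s <;> simp

open Classical in
/-- The number of copies of each node in a set of copies. -/
noncomputable def copyCount (K : Set G.Copy) (u : X ⊕ Y) : ℕ :=
  (Finset.univ.filter fun i : Fin (G.numCopies u) => (⟨u, i⟩ : G.Copy) ∈ K).card

open Classical in
theorem sum_copyCount (K : Set G.Copy) :
    ∑ u, copyCount K u = (Finset.univ.filter fun p : G.Copy => p ∈ K).card := by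
  rw [Finset.card_filter, Fintype.sum_sigma]
  refine Finset.sum_congr rfl fun u _ => ?_
  rw [copyCount, Finset.card_filter]

theorem sum_copyCount_coverCopies_le (a : X → ℕ) (b : Y → ℕ) :
    ∑ u, copyCount (G.coverCopies a b) u ≤ ∑ x, a x + ∑ y, b y := by
  classical
  have : ∑ x, a x + ∑ y, b y = ∑ u, Sum.elim a b u := by simp [Fintype.sum_sum_type]
  rw [this]
  refine Finset.sum_le_sum fun u _ => ?_
  rw [copyCount]
  refine (Finset.card_le_card_of_injOn (t := Finset.range (Sum.elim a b u)) Fin.val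
    (fun i hi => ?_) Fin.val_injective.injOn).trans_eq (Finset.card_range _)
  exact Finset.mem_coe.2 (Finset.mem_range.2 (Finset.mem_filter.1 hi).2)

/-- Each copy in `sideCover` is matched, and its matching edge has an end in the copies of an
optimal cover. Sending it to such an end is injective, because no matching edge has both ends in
`sideCover`. -/
theorem IsMaxWeightMatching.sum_copyCount_sideCover_le (hM : G.IsMaxWeightMatching M) (s : Bool) :
    ∑ u, copyCount (G.sideCover M s) u ≤ G.mwm := by
  classical
  obtain ⟨a, b, h, hs⟩ := G.exists_cover_sum_eq_mwm
  refine le_trans ?_ ((sum_copyCount_coverCopies_le (G := G) a b).trans_eq hs)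
  rw [sum_copyCount, sum_copyCount]
  have hmate : ∀ p : G.Copy, ∃ q, p ∈ G.sideCover M s → (G.unfoldedMatching M).Adj p q := by
    intro p
    by_cases hp : p ∈ G.sideCover M s
    · obtain ⟨q, hq⟩ := exists_adj_of_mem_sideCover hp
      exact ⟨q, fun _ => hq⟩
    · exact ⟨p, fun h => absurd h hp⟩
  choose f hf using hmate
  refine Finset.card_le_card_of_injOn
    (fun p => if p ∈ G.coverCopies a b then p else f p) ?_ ?_
  · intro p hp
    have hp : p ∈ G.sideCover M s := by simpa using hp
    simp only [Finset.coe_filter, Finset.mem_univ, true_and, Set.mem_ofPred_eq]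
    split_ifs with h1
    · exact h1
    · exact (h.mem_coverCopies (hM.1.unfoldedMatching_le (hf p hp))).resolve_left h1
  · intro p hp q hq hpq
    have hp : p ∈ G.sideCover M s := by simpa using hp
    have hq : q ∈ G.sideCover M s := by simpa using hq
    simp only at hpq
    split_ifs at hpq with h1 h2 h2
    · exact hpq
    · exact absurd hp (hM.1.notMem_sideCover (hpq ▸ hf q hq) hq)
    · exact absurd hq (hM.1.notMem_sideCover (hpq ▸ hf p hp) hp)
    · exact hM.1.unfoldedMatching_unique (hf p hp).symm (hpq ▸ (hf q hq).symm)

/-- An edge of weight `w` unfolds to `w` disjoint edges, each needing a copy of `x` or of `y` in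
`K`. -/
theorem isCover_copyCount (K : Set G.Copy)
    (hK : ∀ p q, G.unfolded.Adj p q → p ∈ K ∨ q ∈ K) :
    G.IsCover (fun x => copyCount K (.inl x)) (fun y => copyCount K (.inr y)) := by
  classical
  intro x y
  -- `I` and `J` collect the unfolded edges, numbered by the copy of `x`, that are covered at `x`
  -- and at `y` respectively.
  let I := (Finset.range (G.w x y)).filter fun i =>
    ∃ h : i < G.numCopies (.inl x), (⟨.inl x, i, h⟩ : G.Copy) ∈ K
  let J := (Finset.range (G.w x y)).filter fun i =>
    ∃ h : G.w x y - 1 - i < G.numCopies (.inr y), (⟨.inr y, _, h⟩ : G.Copy) ∈ K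
  have hI : I.card ≤ copyCount K (.inl x) := by
    rw [copyCount, ← Finset.card_map Fin.valEmbedding]
    refine Finset.card_le_card fun i hi => ?_
    obtain ⟨_, h, hk⟩ := Finset.mem_filter.1 hi
    simp only [Finset.mem_map, Finset.mem_filter, Finset.mem_univ, true_and]
    exact ⟨⟨i, h⟩, hk, rfl⟩
  have hJ : J.card ≤ copyCount K (.inr y) := by
    rw [copyCount, ← Finset.card_map Fin.valEmbedding]
    refine Finset.card_le_card_of_injOn (fun i => G.w x y - 1 - i) (fun i hi => ?_) ?_
    · obtain ⟨_, h, hk⟩ := Finset.mem_filter.1 hi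
      simp only [Finset.coe_map, Set.mem_image, Finset.coe_filter, Finset.mem_univ, true_and]
      exact ⟨⟨_, h⟩, hk, rfl⟩
    · intro i hi j hj hij
      have h1 := Finset.mem_range.1 (Finset.mem_filter.1 hi).1
      have h2 := Finset.mem_range.1 (Finset.mem_filter.1 hj).1
      simp only at hij
      omega
  have hIJ : Finset.range (G.w x y) ⊆ I ∪ J := by
    intro i hi
    have hi' := Finset.mem_range.1 hi
    have h1 := G.w_le_numCopies_inl x y
    have h2 := G.w_le_numCopies_inr x y
    have hadj : G.unfolded.Adj ⟨.inl x, i, by omega⟩ ⟨.inr y, G.w x y - 1 - i, by omega⟩ :=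
      unfoldEdges_adj_inl.2 ⟨show 0 < G.w x y by omega, by simp only; omega⟩
    rcases hK _ _ hadj with h | h
    · exact Finset.mem_union_left _ (Finset.mem_filter.2 ⟨hi, _, h⟩)
    · exact Finset.mem_union_right _ (Finset.mem_filter.2 ⟨hi, _, h⟩)
  have := (Finset.card_le_card hIJ).trans (Finset.card_union_le I J)
  rw [Finset.card_range] at this
  simp only
  omega

/-- The cover restricts to `G - u`, and the restriction saves exactly its value at `u`. -/
theorem IsCover.mwm_deleteNode_add_le (h : G.IsCover a b) (u : X ⊕ Y) :
    (G.deleteNode u).mwm + Sum.elim a b u ≤ ∑ x, a x + ∑ y, b y := by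
  classical
  have hc : (G.deleteNode u).IsCover (fun x => a x) (fun y => b y) := fun x y => h x y
  have h1 := hc.mwm_le
  have h2 : ∑ x : {x : X // Sum.inl x ≠ u}, a x = ∑ x, if Sum.inl x ≠ u then a x else 0 := by
    rw [← Finset.sum_filter, ← Finset.sum_subtype_eq_sum_filter]
    exact Finset.sum_congr (by ext; simp) fun _ _ => rfl
  have h3 : ∑ y : {y : Y // Sum.inr y ≠ u}, b y = ∑ y, if Sum.inr y ≠ u then b y else 0 := by
    rw [← Finset.sum_filter, ← Finset.sum_subtype_eq_sum_filter]
    exact Finset.sum_congr (by ext; simp) fun _ _ => rfl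
  rw [h2, h3] at h1
  have h4 : ∑ v, (if v ≠ u then Sum.elim a b v else 0) + Sum.elim a b u = ∑ v, Sum.elim a b v := by
    rw [← Finset.sum_filter, ← Finset.sum_filter_add_sum_filter_not Finset.univ (fun v => v ≠ u)]
    simp [Finset.filter_eq']
  rw [Fintype.sum_sum_type, Fintype.sum_sum_type] at h4
  simp only [Sum.elim_inl, Sum.elim_inr] at h4
  omega

theorem IsMatching.sum_rho_eq (hM : G.IsMatching M) (u : X ⊕ Y) :
    ∑ i : Fin (G.numCopies u), G.rho M ⟨u, i⟩ = copyCount (G.sideCover M u.isLeft) u := by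
  classical
  rw [copyCount, Finset.card_filter]
  refine Finset.sum_congr rfl fun i _ => ?_
  by_cases h : EvenReach G.unfolded (G.unfoldedMatching M) ⟨u, i⟩
  · rw [(hM.rho_eq_zero_iff _).2 h]
    simp [sideCover, h]
  · rw [rho_eq_one_of_ne_zero fun h' => h ((hM.rho_eq_zero_iff _).1 h')]
    simp [sideCover, h]

theorem IsMaxWeightMatching.sum_rho_add_le (hM : G.IsMaxWeightMatching M) (u : X ⊕ Y) :
    ∑ i : Fin (G.numCopies u), G.rho M ⟨u, i⟩ + (G.deleteNode u).mwm ≤ G.mwm := by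
  rw [hM.1.sum_rho_eq u]
  have h := (isCover_copyCount (G.sideCover M u.isLeft)
    fun p q => hM.mem_sideCover _).mwm_deleteNode_add_le u
  have h2 := hM.sum_copyCount_sideCover_le u.isLeft
  rw [Fintype.sum_sum_type] at h2
  have h3 : Sum.elim (fun x => copyCount (G.sideCover M u.isLeft) (.inl x))
      (fun y => copyCount (G.sideCover M u.isLeft) (.inr y)) u =
      copyCount (G.sideCover M u.isLeft) u := by
    cases u <;> rfl
  omega

theorem IsMatching.weight_le_mwm_deleteNode (hM : G.IsMatching M) {u : X ⊕ Y}
    (hu : ∀ e ∈ M, Sum.inl e.1 ≠ u ∧ Sum.inr e.2 ≠ u) : G.weight M ≤ (G.deleteNode u).mwm := by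
  classical
  let f : {x : X // Sum.inl x ≠ u} × {y : Y // Sum.inr y ≠ u} → X × Y := fun e => (e.1, e.2)
  have hf : Function.Injective f := by
    rintro ⟨⟨x, hx⟩, ⟨y, hy⟩⟩ ⟨⟨x', hx'⟩, ⟨y', hy'⟩⟩ h
    simpa [f] using h
  have hM' : (G.deleteNode u).IsMatching (M.preimage f hf.injOn) := by
    refine ⟨fun e he => hM.1 _ (Finset.mem_preimage.1 he), fun e he e' he' h => hf ?_⟩
    refine hM.2 _ (Finset.mem_preimage.1 he) _ (Finset.mem_preimage.1 he') ?_
    exact h.imp (fun h => congrArg Subtype.val h) fun h => congrArg Subtype.val h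
  refine le_trans (le_of_eq ?_) hM'.weight_le_mwm
  refine (Finset.sum_preimage f M hf.injOn (fun e => G.w e.1 e.2) fun e he hn => ?_).symm
  exact absurd ⟨(⟨e.1, (hu e he).1⟩, ⟨e.2, (hu e he).2⟩), rfl⟩ hn

open Classical in
/-- The graph with a new edge of weight `d` that joins `u` to a new node. -/
noncomputable def attach (G : WBGraph X Y) (u : X ⊕ Y) (d : ℕ) :
    WBGraph (Option X) (Option Y) where
  w
    | some x, some y => G.w x y
    | some x, none => if Sum.inl x = u then d else 0
    | none, some y => if Sum.inr y = u then d else 0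
    | none, none => 0

/-- A matching either avoids the new edge, and is a matching of `G`, or uses it, and its other edges
avoid `u`. -/
theorem mwm_attach_le (G : WBGraph X Y) (u : X ⊕ Y) (d : ℕ) :
    (G.attach u d).mwm ≤ max G.mwm (d + (G.deleteNode u).mwm) := by
  classical
  obtain ⟨M, hM, hw⟩ := (G.attach u d).exists_isMaxWeightMatching
  rw [← hw]
  let f : X × Y → Option X × Option Y := fun e => (some e.1, some e.2)
  have hf : Function.Injective f := by
    rintro ⟨x, y⟩ ⟨x', y'⟩ h
    simpa [f] using h
  have hM' : G.IsMatching (M.preimage f hf.injOn) := by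
    refine ⟨fun e he => hM.1 _ (Finset.mem_preimage.1 he), fun e he e' he' h => hf ?_⟩
    refine hM.2 _ (Finset.mem_preimage.1 he) _ (Finset.mem_preimage.1 he') ?_
    exact h.imp (congrArg some) (congrArg some)
  have hpre : ∀ S ⊆ M, (∀ e ∈ M, e ∉ Set.range f → e ∉ S) → (∀ e ∈ M, e ∈ Set.range f → e ∈ S) →
      (G.attach u d).weight S = G.weight (M.preimage f hf.injOn) := by
    intro S hS h1 h2
    have : M.preimage f hf.injOn = S.preimage f hf.injOn := by
      ext e
      simp only [Finset.mem_preimage]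
      exact ⟨fun h => h2 _ h ⟨e, rfl⟩, fun h => hS h⟩
    rw [this]
    exact (Finset.sum_preimage f S hf.injOn (fun e => (G.attach u d).w e.1 e.2)
      fun e he hn => absurd he (h1 e (hS he) hn)).symm
  by_cases hn : ∃ e ∈ M, e ∉ Set.range f
  · obtain ⟨e, he, hef⟩ := hn
    refine le_max_of_le_right ?_
    have hpos := hM.1 e he
    have key : (G.attach u d).w e.1 e.2 = d ∧ ∀ e' ∈ M, e' ≠ e →
        e' ∈ Set.range f ∧ ∀ x y, f (x, y) = e' → Sum.inl x ≠ u ∧ Sum.inr y ≠ u := by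
      rcases e with ⟨_ | x, _ | y⟩
      · simp [attach] at hpos
      · have hy : Sum.inr y = u := by
          by_contra h; simp [attach, h] at hpos
        refine ⟨by simp [attach, hy], ?_⟩
        rintro ⟨_ | x', _ | y'⟩ he' hne
        · have := hM.1 _ he'; simp [attach] at this
        · exact absurd (hM.2 _ he' _ he (Or.inl rfl)) hne
        · have := hM.1 _ he'; simp [attach, ← hy] at this
        · refine ⟨⟨(x', y'), rfl⟩, ?_⟩
          rintro x'' y'' h
          simp only [f, Prod.mk.injEq, Option.some.injEq] at h
          obtain ⟨rfl, rfl⟩ := h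
          refine ⟨by simp [← hy], fun h => ?_⟩
          rw [← hy] at h
          exact hne (hM.2 _ he' _ he (Or.inr (by simpa using h)))
      · have hx : Sum.inl x = u := by
          by_contra h; simp [attach, h] at hpos
        refine ⟨by simp [attach, hx], ?_⟩
        rintro ⟨_ | x', _ | y'⟩ he' hne
        · have := hM.1 _ he'; simp [attach] at this
        · have := hM.1 _ he'; simp [attach, ← hx] at this
        · exact absurd (hM.2 _ he' _ he (Or.inr rfl)) hne
        · refine ⟨⟨(x', y'), rfl⟩, ?_⟩
          rintro x'' y'' h
          simp only [f, Prod.mk.injEq, Option.some.injEq] at h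
          obtain ⟨rfl, rfl⟩ := h
          refine ⟨fun h => ?_, by simp [← hx]⟩
          rw [← hx] at h
          exact hne (hM.2 _ he' _ he (Or.inl (by simpa using h)))
      · exact absurd ⟨(x, y), rfl⟩ hef
    obtain ⟨hd, hrest⟩ := key
    have h1 : (G.attach u d).weight M =
        (G.attach u d).w e.1 e.2 + (G.attach u d).weight (M.erase e) :=
      (Finset.add_sum_erase M (fun e => (G.attach u d).w e.1 e.2) he).symm
    rw [hd] at h1
    rw [h1, hpre (M.erase e) (Finset.erase_subset _ _)
      (fun e' he' h h2 => h (hrest e' he' (Finset.mem_erase.1 h2).1).1)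
      (fun e' he' h => Finset.mem_erase.2 ⟨fun h' => hef (h' ▸ h), he'⟩)]
    refine Nat.add_le_add_left (hM'.weight_le_mwm_deleteNode ?_) _
    rintro ⟨x, y⟩ hxy
    have hxy := Finset.mem_preimage.1 hxy
    exact (hrest _ hxy fun h => hef (h ▸ ⟨_, rfl⟩)).2 x y rfl
  · push Not at hn
    refine le_max_of_le_left ?_
    rw [hpre M subset_rfl (fun e he h => absurd (hn e he) h) fun e he _ => he]
    exact hM'.weight_le_mwm

/-- Some optimal cover has the value `mwm(G) - mwm(G - u)` at `u`. -/
theorem exists_cover_marginal (G : WBGraph X Y) (u : X ⊕ Y) :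
    ∃ a b, G.IsCover a b ∧ ∑ x, a x + ∑ y, b y = G.mwm ∧
      G.mwm ≤ (G.deleteNode u).mwm + Sum.elim a b u := by
  classical
  obtain ⟨a, b, h, hs⟩ := (G.attach u (G.mwm - (G.deleteNode u).mwm)).exists_cover_sum_eq_mwm
  have hle := G.mwm_attach_le u (G.mwm - (G.deleteNode u).mwm)
  have hc : G.IsCover (fun x => a (some x)) (fun y => b (some y)) := fun x y => h (some x) (some y)
  have h1 := hc.mwm_le
  rw [Fintype.sum_option, Fintype.sum_option] at hs
  -- This ensures that the subtraction in the weight of the new edge is not truncated, so `mwm` of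
  -- the larger graph is at most `mwm(G)`.
  have hdel : (G.deleteNode u).mwm ≤ G.mwm := by
    have := hc.mwm_deleteNode_add_le u
    by_contra hlt
    rw [Nat.sub_eq_zero_of_le (by omega), zero_add] at hle
    obtain ⟨a', b', h', hs'⟩ := G.exists_cover_sum_eq_mwm
    have := h'.mwm_deleteNode_add_le u
    omega
  have hu : G.mwm - (G.deleteNode u).mwm ≤
      Sum.elim (fun x => a (some x)) (fun y => b (some y)) u + a none + b none := by
    rcases u with x | y
    · have := h (some x) none
      simp only [attach, if_true] at this
      simp only [Sum.elim_inl]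
      omega
    · have := h none (some y)
      simp only [attach, if_true] at this
      simp only [Sum.elim_inr]
      omega
  -- The restriction already costs at least `mwm(G)`, so both new nodes have value `0`, and `u`
  -- alone must cover the new edge.
  refine ⟨_, _, hc, ?_, ?_⟩ <;> omega

theorem IsMaxWeightMatching.le_sum_rho_add (hM : G.IsMaxWeightMatching M) (u : X ⊕ Y) :
    G.mwm ≤ ∑ i : Fin (G.numCopies u), G.rho M ⟨u, i⟩ + (G.deleteNode u).mwm := by
  classical
  obtain ⟨a, b, h, hs, hu⟩ := G.exists_cover_marginal u
  obtain ⟨h1, h2, h3⟩ := hM.tight h hs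
  have hle : Sum.elim a b u ≤ G.numCopies u := by
    by_contra hlt
    rcases u with x | y
    · simp only [Sum.elim_inl] at hlt
      obtain ⟨y, hy⟩ := h2 x (by omega)
      have := h1 _ hy
      have := G.w_le_numCopies_inl x y
      simp only at *
      omega
    · simp only [Sum.elim_inr] at hlt
      obtain ⟨x, hx⟩ := h3 y (by omega)
      have := h1 _ hx
      have := G.w_le_numCopies_inr x y
      simp only at *
      omega
  have hsum : Sum.elim a b u ≤ ∑ i : Fin (G.numCopies u), G.rho M ⟨u, i⟩ := by
    calc Sum.elim a b u
        = ∑ i : Fin (G.numCopies u), if (i : ℕ) < Sum.elim a b u then 1 else 0 := by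
          rw [Fin.sum_univ_eq_sum_range (fun i => if i < Sum.elim a b u then 1 else 0),
            ← Finset.card_filter]
          have : (Finset.range (G.numCopies u)).filter (· < Sum.elim a b u) =
              Finset.range (Sum.elim a b u) := by
            ext i; simp; omega
          rw [this, Finset.card_range]
      _ ≤ _ := by
          refine Finset.sum_le_sum fun i _ => ?_
          split_ifs with hi
          · rw [rho_eq_one_of_ne_zero]
            intro h0
            exact hM.notMem_coverCopies_of_evenReach h hs ((hM.1.rho_eq_zero_iff _).1 h0) hi
          · exact Nat.zero_le _
  omega

theorem IsMaxWeightMatching.sum_rho (hM : G.IsMaxWeightMatching M) (u : X ⊕ Y) :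
    ((∑ i : Fin (G.numCopies u), G.rho M ⟨u, i⟩ : ℕ) : ℤ) =
      (G.mwm : ℤ) - ((G.deleteNode u).mwm : ℤ) := by
  have h1 := hM.sum_rho_add_le u
  have h2 := hM.le_sum_rho_add u
  omega

end Marginal

end WBGraph

/-! ### Weakest preconditions and step counts for programs -/

namespace RAM

@[simp] theorem State.setReg_reg (s : State) (r v r' : ℕ) :
    (s.setReg r v).reg r' = if r' = r then v else s.reg r' := by
  simp [State.setReg, Function.update_apply]

@[simp] theorem State.setReg_arr (s : State) (r v : ℕ) : (s.setReg r v).arr = s.arr := rfl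

@[simp] theorem State.setArr_reg (s : State) (A i v : ℕ) : (s.setArr A i v).reg = s.reg := rfl

@[simp] theorem State.setArr_arr (s : State) (A i v A' : ℕ) :
    (s.setArr A i v).arr A' = if A' = A then Function.update (s.arr A) i v else s.arr A' := by
  simp [State.setArr, Function.update_apply]

/-- Sequential composition of a list of programs. -/
def Prog.block : List Prog → Prog
  | [] => .skip
  | c :: l => .seq c (Prog.block l)

/-- The weakest precondition of a program without loops, with word bound `B`. -/
def wp (B : ℕ) : Prog → (State → Prop) → State → Prop
  | .skip, Q, s => Q s
  | .const r k, Q, s => k ≤ B ∧ Q (s.setReg r k)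
  | .move r a, Q, s => Q (s.setReg r (s.reg a))
  | .add r a b, Q, s => s.reg a + s.reg b ≤ B ∧ Q (s.setReg r (s.reg a + s.reg b))
  | .sub r a b, Q, s => Q (s.setReg r (s.reg a - s.reg b))
  | .load r A i, Q, s => Q (s.setReg r (s.arr A (s.reg i)))
  | .store A i a, Q, s => Q (s.setArr A (s.reg i) (s.reg a))
  | .seq c d, Q, s => wp B c (wp B d Q) s
  | .ite t c d, Q, s => (t.Holds s → wp B c Q s) ∧ (¬t.Holds s → wp B d Q s)
  | .while _ _, _, _ => False

/-- A bound on the number of steps of a program without loops. -/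
def Prog.cost : Prog → ℕ
  | .seq c d => c.cost + d.cost
  | .ite _ c d => max c.cost d.cost + 1
  | _ => 1

/-- From the state `s`, the program halts within `T` steps in a state that satisfies `Q`. -/
def Achieves (B : ℕ) (c : Prog) (s : State) (T : ℕ) (Q : State → Prop) : Prop :=
  ∃ n s', Exec B c s n s' ∧ n ≤ T ∧ Q s'

theorem Achieves.mono {B : ℕ} {c : Prog} {s : State} {T T' : ℕ} {Q Q' : State → Prop}
    (h : Achieves B c s T Q) (hT : T ≤ T') (hQ : ∀ s', Q s' → Q' s') : Achieves B c s T' Q' := by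
  obtain ⟨n, s', he, hn, hq⟩ := h
  exact ⟨n, s', he, hn.trans hT, hQ _ hq⟩

theorem Achieves.seq {B : ℕ} {c d : Prog} {s : State} {T₁ T₂ : ℕ} {R Q : State → Prop}
    (hc : Achieves B c s T₁ R) (hd : ∀ s', R s' → Achieves B d s' T₂ Q) :
    Achieves B (.seq c d) s (T₁ + T₂) Q := by
  obtain ⟨n, s', he, hn, hr⟩ := hc
  obtain ⟨n', s'', he', hn', hq⟩ := hd s' hr
  exact ⟨_, _, .seq he he', by omega, hq⟩

theorem Achieves.of_wp_cost {B : ℕ} (c : Prog) : ∀ {s : State} {Q : State → Prop}, wp B c Q s →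
    Achieves B c s c.cost Q := by
  induction c with
  | skip => exact fun h => ⟨_, _, .skip _, le_rfl, h⟩
  | const r k => exact fun h => ⟨_, _, .const _ _ _ h.1, le_rfl, h.2⟩
  | move r a => exact fun h => ⟨_, _, .move _ _ _, le_rfl, h⟩
  | add r a b => exact fun h => ⟨_, _, .add _ _ _ _ h.1, le_rfl, h.2⟩
  | sub r a b => exact fun h => ⟨_, _, .sub _ _ _ _, le_rfl, h⟩
  | load r A i => exact fun h => ⟨_, _, .load _ _ _ _, le_rfl, h⟩
  | store A i a => exact fun h => ⟨_, _, .store _ _ _ _, le_rfl, h⟩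
  | seq c d ihc ihd => exact fun h => (ihc h).seq fun s' hs' => ihd hs'
  | ite t c d ihc ihd =>
    intro s Q h
    by_cases ht : t.Holds s
    · obtain ⟨n, s', he, hn, hq⟩ := ihc (h.1 ht)
      exact ⟨_, s', .ite_true ht he, by simp only [Prog.cost]; omega, hq⟩
    · obtain ⟨n, s', he, hn, hq⟩ := ihd (h.2 ht)
      exact ⟨_, s', .ite_false ht he, by simp only [Prog.cost]; omega, hq⟩
  | _ => exact fun h => h.elim

theorem Achieves.of_wp {B : ℕ} {c : Prog} {s : State} {Q : State → Prop} {T : ℕ}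
    (hT : c.cost ≤ T) (h : wp B c Q s) : Achieves B c s T Q :=
  (Achieves.of_wp_cost c h).mono hT fun _ => id

/-- A loop with an invariant that is indexed by a potential, which pays for the steps. -/
theorem Achieves.while_potential {B : ℕ} {t : Test} {c : Prog} (I : ℕ → State → Prop)
    (hbody : ∀ k s, I k s → t.Holds s →
      ∃ T, Achieves B c s T fun s' => ∃ k', k' + T + 1 ≤ k ∧ I k' s') :
    ∀ (k : ℕ) (s : State), I k s →
      Achieves B (.while t c) s (k + 1) fun s' => (∃ k', I k' s') ∧ ¬t.Holds s' := by
  intro k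
  induction k using Nat.strong_induction_on with
  | _ k ih =>
    intro s hs
    by_cases ht : t.Holds s
    · obtain ⟨T, n, s', he, hn, k', hk, hs'⟩ := hbody k s hs ht
      obtain ⟨n', s'', he', hn', hq⟩ := ih k' (by omega) s' hs'
      exact ⟨_, _, .while_true ht he he', by omega, hq⟩
    · exact ⟨_, _, .while_false ht, by omega, ⟨k, hs⟩, ht⟩

/-- A loop that runs `n` times. -/
theorem Achieves.while_count {B : ℕ} {t : Test} {c : Prog} (I : ℕ → State → Prop) (n : ℕ)
    (f : ℕ → ℕ) (hbody : ∀ i s, i < n → I i s → t.Holds s ∧ Achieves B c s (f i) (I (i + 1)))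
    (hend : ∀ s, I n s → ¬t.Holds s) {s : State} (hs : I 0 s) :
    Achieves B (.while t c) s (∑ i ∈ Finset.range n, (f i + 1) + 1) (I n) := by
  suffices h : ∀ k i, i + k = n → ∀ s, I i s →
      Achieves B (.while t c) s (∑ j ∈ Finset.Ico i n, (f j + 1) + 1) (I n) by
    have := h n 0 (by omega) s hs
    rwa [← Finset.range_eq_Ico] at this
  intro k
  induction k with
  | zero =>
    intro i hi s hs
    obtain rfl : i = n := by omega
    exact ⟨_, _, .while_false (hend s hs), by omega, hs⟩
  | succ k ih =>
    intro i hi s hs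
    obtain ⟨ht, m, s', he, hm, hs'⟩ := hbody i s (by omega) hs
    obtain ⟨m', s'', he', hm', hq⟩ := ih (i + 1) (by omega) s' hs'
    refine ⟨_, _, .while_true ht he he', ?_, hq⟩
    rw [Finset.sum_eq_sum_Ico_succ_bot (by omega)]
    omega

end RAM

/-! ### Data structures: linked arcs, mates, search queue -/

namespace RAM

/-- Arcs `1, …, K` with the ends `src` and `dst` form the set `S`; the arcs that leave a node are
linked in decreasing order, starting from `head` and ending with `0`. -/
structure ArcLists (K : ℕ) (head nxt src dst : ℕ → ℕ) (S : Set (ℕ × ℕ)) : Prop where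
  sound : ∀ k, 1 ≤ k → k ≤ K → (src k, dst k) ∈ S
  complete : ∀ a b, (a, b) ∈ S → ∃ k, 1 ≤ k ∧ k ≤ K ∧ src k = a ∧ dst k = b
  head_le : ∀ a, head a ≤ K
  src_head : ∀ a, head a ≠ 0 → src (head a) = a
  le_head : ∀ k, 1 ≤ k → k ≤ K → k ≤ head (src k)
  nxt_lt : ∀ k, 1 ≤ k → k ≤ K → nxt k < k
  src_nxt : ∀ k, 1 ≤ k → k ≤ K → nxt k ≠ 0 → src (nxt k) = src k
  le_nxt : ∀ k, 1 ≤ k → k ≤ K → ∀ k', 1 ≤ k' → k' < k → src k' = src k → k' ≤ nxt k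

theorem ArcLists.empty (nxt src dst : ℕ → ℕ) : ArcLists 0 (fun _ => 0) nxt src dst ∅ := by
  constructor <;> intros <;> first | omega | simp_all

/-- The new arc has the largest number, so putting it in front keeps the list decreasing. Numbers
start at `1`, which leaves `0`, the initial content of memory, as the null link. -/
theorem ArcLists.add {K : ℕ} {head nxt src dst : ℕ → ℕ} {S : Set (ℕ × ℕ)}
    (h : ArcLists K head nxt src dst S) (a b : ℕ) :
    ArcLists (K + 1) (Function.update head a (K + 1)) (Function.update nxt (K + 1) (head a))
      (Function.update src (K + 1) a) (Function.update dst (K + 1) b) (insert (a, b) S) := by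
  have hne : ∀ k, k ≤ K → k ≠ K + 1 := fun k hk => by omega
  constructor
  · intro k hk hk'
    rcases Nat.lt_or_ge K k with h1 | h1
    · obtain rfl : k = K + 1 := by omega
      simp
    · simpa [Function.update_of_ne (hne k h1)] using Or.inr (h.sound k hk h1)
  · intro a' b' hab
    rcases hab with hab | hab
    · simp only [Prod.mk.injEq] at hab
      exact ⟨K + 1, by omega, le_rfl, by simp [hab.1], by simp [hab.2]⟩
    · obtain ⟨k, h1, h2, h3, h4⟩ := h.complete a' b' hab
      exact ⟨k, h1, by omega, by simp [hne k h2, h3], by simp [hne k h2, h4]⟩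
  · intro a'
    have := h.head_le a'
    rw [Function.update_apply]
    split_ifs <;> omega
  · intro a'
    rcases eq_or_ne a' a with rfl | ha
    · simp
    · have := h.src_head a'
      simpa [Function.update_of_ne ha, Function.update_of_ne (hne _ (h.head_le a'))] using this
  · intro k hk hk'
    rcases Nat.lt_or_ge K k with h1 | h1
    · obtain rfl : k = K + 1 := by omega
      simp
    · rw [Function.update_of_ne (hne k h1)]
      have := h.le_head k hk h1
      rw [Function.update_apply]
      split_ifs <;> omega
  · intro k hk hk'
    rcases Nat.lt_or_ge K k with h1 | h1
    · obtain rfl : k = K + 1 := by omega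
      have := h.head_le a
      simp
      omega
    · rw [Function.update_of_ne (hne k h1)]
      exact h.nxt_lt k hk h1
  · intro k hk hk'
    rcases Nat.lt_or_ge K k with h1 | h1
    · obtain rfl : k = K + 1 := by omega
      intro h0
      simp only [Function.update_self] at h0 ⊢
      rw [Function.update_of_ne (hne _ (h.head_le a))]
      exact h.src_head a h0
    · have h2 := h.nxt_lt k hk h1
      rw [Function.update_of_ne (hne k h1), Function.update_of_ne (hne k h1),
        Function.update_of_ne (hne _ (by omega))]
      exact h.src_nxt k hk h1
  · intro k hk hk' k' h1 h2
    have hk1 : k' ≠ K + 1 := by omega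
    rw [Function.update_of_ne hk1]
    rcases Nat.lt_or_ge K k with h3 | h3
    · obtain rfl : k = K + 1 := by omega
      simp only [Function.update_self]
      rintro rfl
      exact h.le_head k' h1 (by omega)
    · rw [Function.update_of_ne (hne k h3), Function.update_of_ne (hne k h3)]
      exact h.le_nxt k hk h3 k' h1 h2

/-- `mate a` is `b + 1` for some `b` with `(a, b) ∈ T`, or `0` if there is no such `b`. -/
structure IsMate (mate : ℕ → ℕ) (T : Set (ℕ × ℕ)) : Prop where
  sound : ∀ a, mate a ≠ 0 → (a, mate a - 1) ∈ T
  complete : ∀ a b, (a, b) ∈ T → mate a ≠ 0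

theorem IsMate.empty : IsMate (fun _ => 0) ∅ := by
  constructor <;> simp

theorem IsMate.add {mate : ℕ → ℕ} {T : Set (ℕ × ℕ)} (h : IsMate mate T) (a b : ℕ) :
    IsMate (Function.update mate a (b + 1)) (insert (a, b) T) := by
  constructor
  · intro a'
    rcases eq_or_ne a' a with rfl | ha
    · simp
    · simpa [Function.update_of_ne ha, ha] using h.sound a'
  · intro a' b' hab
    rcases eq_or_ne a' a with rfl | ha
    · simp
    · rw [Function.update_of_ne ha]
      rcases hab with hab | hab
      · simp_all
      · exact h.complete a' b' hab

/-- The nodes that are found from the unmatched nodes by a step along an edge in `S` and a matching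
edge in `T`. -/
inductive Found (N : ℕ) (S T : Set (ℕ × ℕ)) : ℕ → Prop
  | base {a : ℕ} (ha : a < N) (h : ∀ b, (a, b) ∉ T) : Found N S T a
  | step {a b c : ℕ} (hc : Found N S T c) (hcb : (c, b) ∈ S) (hba : (b, a) ∈ T) : Found N S T a

/-- The queue holds distinct found nodes, which are the marked ones. -/
structure QueueInv (N : ℕ) (S T : Set (ℕ × ℕ)) (good Q : ℕ → ℕ) (tl : ℕ) : Prop where
  inj : ∀ i < tl, ∀ j < tl, Q i = Q j → i = j
  good_queue : ∀ i < tl, good (Q i) = 1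
  good_or : ∀ a, good a = 0 ∨ good a = 1 ∧ ∃ i < tl, Q i = a
  lt : ∀ i < tl, Q i < N
  found : ∀ i < tl, Found N S T (Q i)

theorem QueueInv.empty (N : ℕ) (S T : Set (ℕ × ℕ)) (Q : ℕ → ℕ) :
    QueueInv N S T (fun _ => 0) Q 0 := by
  constructor <;> simp

theorem QueueInv.push {N : ℕ} {S T : Set (ℕ × ℕ)} {good Q : ℕ → ℕ} {tl : ℕ}
    (h : QueueInv N S T good Q tl) {a : ℕ} (ha : a < N) (hf : Found N S T a) (h0 : good a = 0) :
    QueueInv N S T (Function.update good a 1) (Function.update Q tl a) (tl + 1) := by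
  have hQ : ∀ i < tl, Q i ≠ a := by
    rintro i hi rfl
    have := h.good_queue i hi
    omega
  have hlt : ∀ i < tl, Function.update Q tl a i = Q i :=
    fun i hi => Function.update_of_ne (by omega) _ _
  have htl : ∀ i, i < tl + 1 → i < tl ∨ i = tl := fun i hi => by omega
  constructor
  · intro i hi j hj hij
    rcases htl i hi with h1 | rfl <;> rcases htl j hj with h2 | rfl
    · rw [hlt i h1, hlt j h2] at hij
      exact h.inj i h1 j h2 hij
    · rw [hlt i h1, Function.update_self] at hij
      exact absurd hij (hQ i h1)
    · rw [hlt j h2, Function.update_self] at hij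
      exact absurd hij.symm (hQ j h2)
    · rfl
  · intro i hi
    rcases htl i hi with h1 | rfl
    · rw [hlt i h1, Function.update_of_ne (hQ i h1)]
      exact h.good_queue i h1
    · simp
  · intro a'
    rcases eq_or_ne a' a with rfl | hne
    · exact Or.inr ⟨by simp, tl, by omega, by simp⟩
    · rw [Function.update_of_ne hne]
      refine (h.good_or a').imp_right ?_
      rintro ⟨h1, i, hi, h2⟩
      exact ⟨h1, i, by omega, by rw [hlt i hi, h2]⟩
  · intro i hi
    rcases htl i hi with h1 | rfl
    · rw [hlt i h1]; exact h.lt i h1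
    · simpa using ha
  · intro i hi
    rcases htl i hi with h1 | rfl
    · rw [hlt i h1]; exact h.found i h1
    · simpa using hf

/-- The entries are distinct and below `N`. This bounds the tail pointer by the word size and the
number of pops by `N`. -/
theorem QueueInv.le {N : ℕ} {S T : Set (ℕ × ℕ)} {good Q : ℕ → ℕ} {tl : ℕ}
    (h : QueueInv N S T good Q tl) : tl ≤ N := by
  have := Finset.card_le_card_of_injOn (s := Finset.range tl) (t := Finset.range N) Q
    (fun i hi => by simpa using h.lt i (by simpa using hi))
    (fun i hi j hj hij => h.inj i (by simpa using hi) j (by simpa using hj) hij)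
  simpa using this

/-- When the queue is exhausted, exactly the found nodes are marked. -/
theorem QueueInv.good_iff {N : ℕ} {S T : Set (ℕ × ℕ)} {good Q : ℕ → ℕ} {tl : ℕ}
    (h : QueueInv N S T good Q tl) {K : ℕ} {head nxt src dst mate : ℕ → ℕ}
    (hS : ArcLists K head nxt src dst S) (hT : IsMate mate T)
    (huniq : ∀ a b c, (a, b) ∈ T → (a, c) ∈ T → b = c)
    (hbase : ∀ a < N, mate a = 0 → good a = 1)
    (hclosed : ∀ k, 1 ≤ k → k ≤ K → (∃ i < tl, Q i = src k) → mate (dst k) ≠ 0 →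
      good (mate (dst k) - 1) = 1) (a : ℕ) : good a = 1 ↔ Found N S T a := by
  constructor
  · intro ha
    rcases h.good_or a with h0 | ⟨_, i, hi, rfl⟩
    · omega
    · exact h.found i hi
  · intro ha
    induction ha with
    | base ha hn => exact hbase _ ha (by_contra fun h0 => hn _ (hT.sound _ h0))
    | @step a b c hc hcb hba ih =>
      obtain ⟨k, h1, h2, h3, h4⟩ := hS.complete c b hcb
      have h5 := hT.complete b a hba
      obtain rfl := huniq _ _ _ hba (hT.sound b h5)
      rw [← h4] at h5 ⊢
      refine hclosed k h1 h2 ?_ h5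
      rcases h.good_or c with h0 | ⟨_, i, hi, h6⟩
      · omega
      · exact ⟨i, hi, by rw [h6, h3]⟩

end RAM

/-! ### Numbering of nodes, copies and arcs -/

namespace RAM

/-- The data that the program reads: a list of `m` weighted edges between `p` and `q` nodes,
with marks. -/
structure Input where
  (m p q : ℕ)
  (xs ys ws mark : ℕ → ℕ)

namespace Input

variable (D : Input)

/-- The largest weight at the node with index `u` among the first `j` edges. -/
def maxWeight (j u : ℕ) : ℕ :=
  (Finset.range j).sup fun i => if D.xs i = u ∨ D.ys i + D.p = u then D.ws i else 0

theorem maxWeight_succ (j u : ℕ) : D.maxWeight (j + 1) u =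
    max (D.maxWeight j u) (if D.xs j = u ∨ D.ys j + D.p = u then D.ws j else 0) := by
  rw [maxWeight, Finset.range_add_one, Finset.sup_insert, sup_comm]
  rfl

theorem ws_le_maxWeight_xs {j : ℕ} (hj : j < D.m) : D.ws j ≤ D.maxWeight D.m (D.xs j) := by
  have := Finset.le_sup (f := fun i => if D.xs i = D.xs j ∨ D.ys i + D.p = D.xs j then D.ws i else 0)
    (Finset.mem_range.2 hj)
  simp only [true_or, if_true] at this
  exact this

theorem ws_le_maxWeight_ys {j : ℕ} (hj : j < D.m) :
    D.ws j ≤ D.maxWeight D.m (D.ys j + D.p) := by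
  have := Finset.le_sup
    (f := fun i => if D.xs i = D.ys j + D.p ∨ D.ys i + D.p = D.ys j + D.p then D.ws i else 0)
    (Finset.mem_range.2 hj)
  simp only [or_true, if_true] at this
  exact this

/-- The index of the first copy of the node with index `u`. -/
def off (u : ℕ) : ℕ := ∑ i ∈ Finset.range u, D.maxWeight D.m i

theorem off_succ (u : ℕ) : D.off (u + 1) = D.off u + D.maxWeight D.m u :=
  Finset.sum_range_succ _ _

theorem off_mono {u v : ℕ} (h : u ≤ v) : D.off u ≤ D.off v :=
  Finset.sum_le_sum_of_subset (Finset.range_mono h)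

/-- The total weight of the first `j` edges. -/
def sumWeight (j : ℕ) : ℕ := ∑ i ∈ Finset.range j, D.ws i

theorem sumWeight_succ (j : ℕ) : D.sumWeight (j + 1) = D.sumWeight j + D.ws j :=
  Finset.sum_range_succ _ _

theorem sumWeight_mono {i j : ℕ} (h : i ≤ j) : D.sumWeight i ≤ D.sumWeight j :=
  Finset.sum_le_sum_of_subset (Finset.range_mono h)

/-- The number of copies. -/
def size : ℕ := D.off (D.p + D.q)

/-- Ranges of the data, for the word bound `B`. -/
structure Valid (B : ℕ) : Prop where
  xs_lt : ∀ j < D.m, D.xs j < D.p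
  ys_lt : ∀ j < D.m, D.ys j < D.q
  one_le : 1 ≤ B
  m_le : D.m ≤ B
  pq_le : D.p + D.q ≤ B
  sum_le : 2 * D.sumWeight D.m ≤ B
  size_le : D.size ≤ B

/-- The first end of the edge number `u` in the unfolding of the edge number `j`. -/
def fstEnd (j u : ℕ) : ℕ := D.off (D.xs j) + u

/-- The second end of the edge number `u` in the unfolding of the edge number `j`. -/
def sndEnd (j u : ℕ) : ℕ := D.off (D.ys j + D.p) + D.ws j - 1 - u

variable {D} in
theorem Valid.fst_lt {B : ℕ} (hD : D.Valid B) {j : ℕ} (hj : j < D.m) :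
    D.off (D.xs j) + D.ws j ≤ D.size := by
  have h1 := hD.xs_lt j hj
  have h2 := D.ws_le_maxWeight_xs hj
  have h3 := D.off_mono (show D.xs j + 1 ≤ D.p + D.q by omega)
  rw [off_succ] at h3
  unfold size
  omega

variable {D} in
theorem Valid.snd_lt {B : ℕ} (hD : D.Valid B) {j : ℕ} (hj : j < D.m) :
    D.off (D.ys j + D.p) + D.ws j ≤ D.size := by
  have h1 := hD.ys_lt j hj
  have h2 := D.ws_le_maxWeight_ys hj
  have h3 := D.off_mono (show D.ys j + D.p + 1 ≤ D.p + D.q by omega)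
  rw [off_succ] at h3
  unfold size
  omega

/-- The arcs, in both directions, from the edges before number `j` with the property `φ`,
and the first `t` ones of the edge number `j`. -/
def arcs (φ : ℕ → Prop) (j t : ℕ) : Set (ℕ × ℕ) :=
  {e | ∃ i u, φ i ∧ (i < j ∧ u < D.ws i ∨ i = j ∧ u < t) ∧
    (e = (D.fstEnd i u, D.sndEnd i u) ∨ e = (D.sndEnd i u, D.fstEnd i u))}

theorem arcs_zero (φ : ℕ → Prop) : D.arcs φ 0 0 = ∅ := by
  ext e; simp [arcs]

theorem arcs_next (φ : ℕ → Prop) (j : ℕ) : D.arcs φ j (D.ws j) = D.arcs φ (j + 1) 0 := by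
  ext e
  simp only [arcs, Set.mem_ofPred_eq]
  refine exists_congr fun i => exists_congr fun u => and_congr_right fun _ => and_congr_left fun _ => ?_
  constructor
  · rintro (h | ⟨rfl, h⟩)
    · exact Or.inl ⟨by omega, h.2⟩
    · exact Or.inl ⟨by omega, h⟩
  · rintro (⟨h, h'⟩ | h)
    · rcases Nat.lt_or_ge i j with h1 | h1
      · exact Or.inl ⟨h1, h'⟩
      · obtain rfl : i = j := by omega
        exact Or.inr ⟨rfl, h'⟩
    · omega

theorem arcs_succ {φ : ℕ → Prop} {j t : ℕ} (h : φ j) : D.arcs φ j (t + 1) =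
    insert (D.sndEnd j t, D.fstEnd j t) (insert (D.fstEnd j t, D.sndEnd j t) (D.arcs φ j t)) := by
  ext e
  simp only [arcs, Set.mem_ofPred_eq, Set.mem_insert_iff]
  constructor
  · rintro ⟨i, u, hi, (h1 | ⟨rfl, h1⟩), h2⟩
    · exact Or.inr (Or.inr ⟨i, u, hi, Or.inl h1, h2⟩)
    · rcases Nat.lt_or_ge u t with h3 | h3
      · exact Or.inr (Or.inr ⟨i, u, hi, Or.inr ⟨rfl, h3⟩, h2⟩)
      · obtain rfl : u = t := by omega
        tauto
  · rintro (rfl | rfl | ⟨i, u, hi, h1, h2⟩)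
    · exact ⟨j, t, h, Or.inr ⟨rfl, by omega⟩, Or.inr rfl⟩
    · exact ⟨j, t, h, Or.inr ⟨rfl, by omega⟩, Or.inl rfl⟩
    · exact ⟨i, u, hi, h1.imp_right fun h => ⟨h.1, by omega⟩, h2⟩

theorem arcs_succ_of_not {φ : ℕ → Prop} {j t : ℕ} (h : ¬φ j) :
    D.arcs φ j (t + 1) = D.arcs φ j t := by
  ext e
  simp only [arcs, Set.mem_ofPred_eq]
  refine exists_congr fun i => exists_congr fun u => and_congr_right fun hi => ?_
  have : i ≠ j := fun h' => h (h' ▸ hi)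
  simp [this]

/-- The registers and arrays that are constant during a run. -/
structure Ready (s : State) : Prop where
  r0 : s.reg 0 = D.m
  r1 : s.reg 1 = D.p
  r2 : s.reg 2 = D.q
  r3 : s.reg 3 = 0
  r4 : s.reg 4 = 1
  r5 : s.reg 5 = D.p + D.q
  a0 : s.arr 0 = D.xs
  a1 : s.arr 1 = D.ys
  a2 : s.arr 2 = D.ws
  a3 : s.arr 3 = D.mark

@[simp] theorem ready_setReg {s : State} {r v : ℕ} (hr : 5 < r) :
    D.Ready (s.setReg r v) ↔ D.Ready s := by
  have h : ∀ i, i ≤ 5 → i ≠ r := fun i hi => by omega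
  constructor <;> rintro ⟨⟩ <;> constructor <;> simp_all

@[simp] theorem ready_setArr {s : State} {A i v : ℕ} (hA : 3 < A) :
    D.Ready (s.setArr A i v) ↔ D.Ready s := by
  have h : ∀ i, i ≤ 3 → i ≠ A := fun i hi => by omega
  constructor <;> rintro ⟨⟩ <;> constructor <;> simp_all

/-- The offsets are in array `7` and the number of copies is in register `14`. -/
structure Offsets (s : State) : Prop where
  ready : D.Ready s
  r14 : s.reg 14 = D.size
  a7 : ∀ u ≤ D.p + D.q, s.arr 7 u = D.off u

@[simp] theorem offsets_setReg {s : State} {r v : ℕ} (hr : 5 < r) (hr' : r ≠ 14) :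
    D.Offsets (s.setReg r v) ↔ D.Offsets s := by
  constructor <;> rintro ⟨⟩ <;> constructor <;> simp_all [hr'.symm]

@[simp] theorem offsets_setArr {s : State} {A i v : ℕ} (hA : 3 < A) (hA' : A ≠ 7) :
    D.Offsets (s.setArr A i v) ↔ D.Offsets s := by
  constructor <;> rintro ⟨⟩ <;> constructor <;> simp_all [hA'.symm]

end Input

/-- The arrays that have to be `0` initially. -/
structure Fresh (s : State) : Prop where
  a8 : s.arr 8 = fun _ => 0
  a11 : s.arr 11 = fun _ => 0
  a12 : s.arr 12 = fun _ => 0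

@[simp] theorem fresh_setReg {s : State} {r v : ℕ} : Fresh (s.setReg r v) ↔ Fresh s := by
  constructor <;> rintro ⟨⟩ <;> constructor <;> simp_all

@[simp] theorem fresh_setArr {s : State} {A i v : ℕ} (h1 : A ≠ 8) (h2 : A ≠ 11) (h3 : A ≠ 12) :
    Fresh (s.setArr A i v) ↔ Fresh s := by
  constructor <;> rintro ⟨⟩ <;> constructor <;> simp_all [h1.symm, h2.symm, h3.symm]

/-! ### Programs for the heaviest weights and the offsets -/

variable {D : Input} {B : ℕ} {s : State}

def maxWeightBody : Prog := .block
  [.load 7 0 6, .load 8 1 6, .add 8 8 1, .load 9 2 6,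
   .load 10 6 7, .ite (.lt 10 9) (.store 6 7 9) .skip,
   .load 10 6 8, .ite (.lt 10 9) (.store 6 8 9) .skip,
   .add 6 6 4]

/-- Computes the largest weight at each node in array `6`. -/
def maxWeightProg : Prog := .seq (.const 6 0) (.while (.lt 6 0) maxWeightBody)

theorem maxWeight_spec (hD : D.Valid B) (hs : D.Ready s) (hf : Fresh s)
    (h6 : s.arr 6 = fun _ => 0) :
    Achieves B maxWeightProg s (20 * D.m + 2)
      fun s => D.Ready s ∧ Fresh s ∧ s.arr 6 = D.maxWeight D.m := by
  have h1 : Achieves B (.const 6 0) s 1 fun s =>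
      s.reg 6 = 0 ∧ D.Ready s ∧ Fresh s ∧ s.arr 6 = D.maxWeight 0 := by
    refine .of_wp le_rfl ?_
    simp [wp, hs, hf, h6]
    rfl
  refine (h1.seq fun s' hs' => Achieves.while_count (fun j s => s.reg 6 = j ∧ D.Ready s ∧ Fresh s ∧
    s.arr 6 = D.maxWeight j) D.m (fun _ => 19) ?_ ?_ hs').mono ?_ fun s h => h.2
  · rintro j s hj ⟨r6, hr, hf, a6⟩
    have := hD.xs_lt j hj
    have := hD.ys_lt j hj
    have := hD.pq_le
    have := hD.m_le
    have ⟨r0, r1, r2, r3, r4, r5, a0, a1, a2, a3⟩ := hr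
    refine ⟨by simp [Test.Holds, *], .of_wp (by decide) ?_⟩
    simp [wp, maxWeightBody, Prog.block, Test.Holds, *]
    -- Nodes of the second side are shifted by `p`, so the two updates concern different cells.
    have hne : D.ys j + D.p ≠ D.xs j := by omega
    have hB : D.ys j + D.p ≤ B := by omega
    have hj' : j < B := by omega
    simp only [hB, hj', hne, Function.update_of_ne, ne_eq, not_false_eq_true, true_and]
    refine ⟨fun h1 => ⟨fun h2 => ?_, fun h2 => ?_⟩, fun h1 => ⟨fun h2 => ?_, fun h2 => ?_⟩⟩ <;>
      funext u <;> rw [D.maxWeight_succ] <;> rcases eq_or_ne u (D.xs j) with hu | hu <;>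
      rcases eq_or_ne u (D.ys j + D.p) with hu' | hu' <;>
      simp_all [Ne.symm] <;> omega
  · rintro s ⟨h, ⟨⟩, -⟩
    simp_all [Test.Holds]
  · simp; omega

def offsetBody : Prog := .block [.store 7 6 14, .load 9 6 6, .add 14 14 9, .add 6 6 4]

/-- Computes the offsets in array `7`, and the number of copies in register `14`. -/
def offsetProg : Prog :=
  .seq (.block [.const 14 0, .const 6 0]) (.seq (.while (.lt 6 5) offsetBody) (.store 7 6 14))

theorem offset_spec (hD : D.Valid B) (hs : D.Ready s) (hf : Fresh s)
    (h6 : s.arr 6 = D.maxWeight D.m) :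
    Achieves B offsetProg s (6 * (D.p + D.q) + 5) fun s => D.Offsets s ∧ Fresh s := by
  have h1 : Achieves B (.block [.const 14 0, .const 6 0]) s 3 fun s => s.reg 6 = 0 ∧ D.Ready s ∧
      Fresh s ∧ s.arr 6 = D.maxWeight D.m ∧ s.reg 14 = D.off 0 ∧
      ∀ u < 0, s.arr 7 u = D.off u := by
    refine .of_wp le_rfl ?_
    simp [wp, Prog.block, hs, hf, h6, Input.off]
  refine (h1.seq fun s' hs' => (Achieves.while_count (fun j s => s.reg 6 = j ∧ D.Ready s ∧
    Fresh s ∧ s.arr 6 = D.maxWeight D.m ∧ s.reg 14 = D.off j ∧ ∀ u < j, s.arr 7 u = D.off u)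
    (D.p + D.q) (fun _ => 5) ?_ ?_ hs').seq (T₂ := 1) ?_).mono ?_ fun s h => h
  · rintro j s hj ⟨r6, hr, hf, a6, r14, a7⟩
    have h1 := hD.size_le
    have h2 := D.off_mono (show j + 1 ≤ D.p + D.q by omega)
    have := hD.pq_le
    rw [D.off_succ] at h2
    unfold Input.size at h1
    have ⟨r0, r1, r2, r3, r4, r5, a0, a1, a2, a3⟩ := hr
    refine ⟨by simp [Test.Holds, *], .of_wp (by decide) ?_⟩
    simp [wp, offsetBody, Prog.block, *]
    refine ⟨by omega, by omega, (D.off_succ j).symm, fun u hu => ?_⟩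
    rcases eq_or_ne u j with rfl | hu'
    · simp
    · rw [Function.update_of_ne hu', a7 u (by omega)]
  · rintro s ⟨h, ⟨⟩, -⟩
    simp_all [Test.Holds]
  · rintro s ⟨r6, hr, hf, a6, r14, a7⟩
    refine .of_wp le_rfl ?_
    simp [wp, hf]
    refine ⟨by simpa using hr, by simpa [Input.size] using r14, fun u hu => ?_⟩
    rcases eq_or_ne u (D.p + D.q) with rfl | hu'
    · simp [r6, r14]
    · simp [r6, Function.update_of_ne hu', a7 u (by omega)]
  · simp; omega

end RAM

/-! ### Building the unfolded graph -/

namespace RAM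

variable {D : Input} {B : ℕ} {s : State}

/-- The linked lists of arcs, and the matching, that the arrays of a state contain. -/
structure Links where
  (head nxt src dst mate : ℕ → ℕ)

/-- The lists represent the unfolded graph and its matching. -/
structure Links.Rep (L : Links) (D : Input) : Prop where
  lists : ArcLists (2 * D.sumWeight D.m) L.head L.nxt L.src L.dst (D.arcs (fun _ => True) D.m 0)
  mate : IsMate L.mate (D.arcs (fun j => D.mark j = 1) D.m 0)

/-- The state after the construction of the unfolded graph. -/
structure Linked (D : Input) (L : Links) (s : State) : Prop where
  offsets : D.Offsets s
  a8 : s.arr 8 = L.head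
  a9 : s.arr 9 = L.nxt
  a14 : s.arr 14 = L.src
  a10 : s.arr 10 = L.dst
  a11 : s.arr 11 = L.mate

@[simp] theorem linked_setReg {L : Links} {r v : ℕ} (hr : 5 < r) (hr' : r ≠ 14) :
    Linked D L (s.setReg r v) ↔ Linked D L s := by
  constructor <;> rintro ⟨⟩ <;> constructor <;> simp_all

@[simp] theorem linked_setArr {L : Links} {A i v : ℕ} (h : 3 < A) (h' : A < 7 ∨ A = 12 ∨ A = 13) :
    Linked D L (s.setArr A i v) ↔ Linked D L s := by
  have h1 : A ≠ 7 ∧ A ≠ 8 ∧ A ≠ 9 ∧ A ≠ 10 ∧ A ≠ 11 ∧ A ≠ 14 := by omega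
  have h2 : 8 ≠ A ∧ 9 ≠ A ∧ 10 ≠ A ∧ 11 ≠ A ∧ 14 ≠ A := by omega
  constructor <;> rintro ⟨⟩ <;> constructor <;> simp_all

/-- Registers `11` and `12` run through the copies of the two ends in opposite directions. Register
`12` starts one too high, so it is lowered before use. Register `13` numbers the arcs, two per
unfolded edge; mates are stored plus one, so that `0` means unmatched. -/
def arcBody : Prog := .block
  [.sub 12 12 4,
   .add 13 13 4, .load 16 8 11, .store 9 13 16, .store 8 11 13, .store 14 13 11, .store 10 13 12,
   .add 13 13 4, .load 16 8 12, .store 9 13 16, .store 8 12 13, .store 14 13 12, .store 10 13 11,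
   .ite (.eq 15 4) (.block [.add 16 12 4, .store 11 11 16, .add 16 11 4, .store 11 12 16]) .skip,
   .add 11 11 4, .add 10 10 4]

def edgeProg : Prog :=
  .seq (.block [.load 7 0 6, .load 8 1 6, .add 8 8 1, .load 9 2 6, .load 15 3 6, .load 11 7 7,
    .load 12 7 8, .add 12 12 9, .const 10 0])
  (.seq (.while (.lt 10 9) arcBody) (.add 6 6 4))

/-- Unfolds the edges into linked lists of arcs, and records the matching in array `11`. -/
def linkProg : Prog :=
  .seq (.block [.const 13 0, .const 6 0]) (.while (.lt 6 0) edgeProg)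

/-- The invariant of the unfolding, after `t` arcs of edge number `j`. -/
structure LinkInv (D : Input) (j t : ℕ) (s : State) : Prop where
  offsets : D.Offsets s
  r6 : s.reg 6 = j
  r13 : s.reg 13 = 2 * (D.sumWeight j + t)
  a12 : s.arr 12 = fun _ => 0
  lists : ArcLists (2 * (D.sumWeight j + t)) (s.arr 8) (s.arr 9) (s.arr 14) (s.arr 10)
    (D.arcs (fun _ => True) j t)
  mate : IsMate (s.arr 11) (D.arcs (fun j => D.mark j = 1) j t)

theorem arc_step (hD : D.Valid B) {j t : ℕ} (hj : j < D.m) (ht : t < D.ws j)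
    (hs : LinkInv D j t s) (h10 : s.reg 10 = t) (h9 : s.reg 9 = D.ws j)
    (h15 : s.reg 15 = D.mark j) (h11 : s.reg 11 = D.fstEnd j t)
    (h12 : s.reg 12 = D.sndEnd j t + 1) :
    Achieves B arcBody s 26 fun s => LinkInv D j (t + 1) s ∧ s.reg 10 = t + 1 ∧
      s.reg 9 = D.ws j ∧ s.reg 15 = D.mark j ∧ s.reg 11 = D.fstEnd j (t + 1) ∧
      s.reg 12 = D.sndEnd j t := by
  obtain ⟨ho, r6, r13, a12, hl, hm⟩ := hs
  have ⟨hr, r14, a7⟩ := ho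
  have ⟨r0, r1, r2, r3, r4, r5, a0, a1, a2, a3⟩ := hr
  have b1 := hD.fst_lt hj
  have b2 := hD.snd_lt hj
  have b3 := hD.size_le
  have b4 := hD.sum_le
  have b5 := D.sumWeight_mono (show j + 1 ≤ D.m by omega)
  rw [D.sumWeight_succ] at b5
  have e1 : D.fstEnd j t + 1 = D.fstEnd j (t + 1) := rfl
  have c1 : D.fstEnd j t < B := by unfold Input.fstEnd; omega
  have c2 : D.sndEnd j t < B := by unfold Input.sndEnd; omega
  have hl' := (hl.add (D.fstEnd j t) (D.sndEnd j t)).add (D.sndEnd j t) (D.fstEnd j t)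
  have hm' := (hm.add (D.fstEnd j t) (D.sndEnd j t)).add (D.sndEnd j t) (D.fstEnd j t)
  rw [← D.arcs_succ trivial] at hl'
  have e2 : 2 * (D.sumWeight j + (t + 1)) = 2 * (D.sumWeight j + t) + 1 + 1 := by omega
  refine .of_wp (by decide) ?_
  simp [wp, arcBody, Prog.block, Test.Holds, *]
  refine ⟨by omega, by omega, fun hk => ⟨by omega, by omega, ?_⟩,
    fun hk => ⟨by omega, by omega, ?_⟩⟩
  · rw [← D.arcs_succ (φ := fun j => D.mark j = 1) hk] at hm'
    constructor <;> simp [*]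
    exact hm'
  · rw [← D.arcs_succ_of_not (φ := fun j => D.mark j = 1) hk] at hm
    constructor <;> simp [*]

theorem edge_step (hD : D.Valid B) {j : ℕ} (hj : j < D.m) (hs : LinkInv D j 0 s) :
    Achieves B edgeProg s (27 * D.ws j + 13) (LinkInv D (j + 1) 0) := by
  have h1 : Achieves B (.block [.load 7 0 6, .load 8 1 6, .add 8 8 1, .load 9 2 6, .load 15 3 6,
      .load 11 7 7, .load 12 7 8, .add 12 12 9, .const 10 0]) s 10 fun s => LinkInv D j 0 s ∧
      s.reg 10 = 0 ∧ s.reg 9 = D.ws j ∧ s.reg 15 = D.mark j ∧ s.reg 11 = D.fstEnd j 0 ∧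
      s.reg 12 + 0 = D.off (D.ys j + D.p) + D.ws j := by
    obtain ⟨ho, r6, r13, a12, hl, hm⟩ := hs
    have ⟨hr, r14, a7⟩ := ho
    have ⟨r0, r1, r2, r3, r4, r5, a0, a1, a2, a3⟩ := hr
    have b1 := hD.xs_lt j hj
    have b2 := hD.ys_lt j hj
    have b3 := hD.snd_lt hj
    have b4 := hD.size_le
    have b5 := hD.pq_le
    have e1 := a7 (D.xs j) (by omega)
    have e2 := a7 (D.ys j + D.p) (by omega)
    refine .of_wp (by decide) ?_
    simp [wp, Prog.block, *]
    refine ⟨by omega, by omega, ?_, rfl⟩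
    constructor <;> simp [*]
    simpa using hl
  -- The value of register `12` is stated as a sum because `sndEnd` is a truncated difference, which
  -- need not be meaningful at the exit `t = w`.
  refine (h1.seq fun s' hs' => (Achieves.while_count (fun t s => LinkInv D j t s ∧
    s.reg 10 = t ∧ s.reg 9 = D.ws j ∧ s.reg 15 = D.mark j ∧ s.reg 11 = D.fstEnd j t ∧
    s.reg 12 + t = D.off (D.ys j + D.p) + D.ws j) (D.ws j) (fun _ => 26) ?_ ?_ hs').seq
    (T₂ := 1) ?_).mono ?_ fun s h => h
  · rintro t s ht ⟨hs, h10, h9, h15, h11, h12⟩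
    refine ⟨by simp [Test.Holds, *], ?_⟩
    have e : s.reg 12 = D.sndEnd j t + 1 := by unfold Input.sndEnd; omega
    refine (arc_step hD hj ht hs h10 h9 h15 h11 e).mono le_rfl ?_
    rintro s ⟨hs, h10, h9, h15, h11, h12⟩
    refine ⟨hs, h10, h9, h15, h11, ?_⟩
    unfold Input.sndEnd at h12
    omega
  · rintro s ⟨hs, h10, h9, -⟩
    simp [Test.Holds, *]
  · rintro s ⟨⟨ho, r6, r13, a12, hl, hm⟩, -⟩
    have ⟨hr, r14, a7⟩ := ho
    have ⟨r0, r1, r2, r3, r4, r5, a0, a1, a2, a3⟩ := hr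
    have := hD.m_le
    refine .of_wp le_rfl ?_
    rw [D.arcs_next] at hl hm
    rw [← D.sumWeight_succ] at hl r13
    simp [wp, *]
    refine ⟨by omega, ?_⟩
    constructor <;> simp [*]
  · simp; omega

theorem link_spec (hD : D.Valid B) (hs : D.Offsets s) (hf : Fresh s) :
    Achieves B linkProg s (27 * D.sumWeight D.m + 14 * D.m + 4)
      fun s => s.arr 12 = (fun _ => 0) ∧ ∃ L : Links, L.Rep D ∧ Linked D L s := by
  have h1 : Achieves B (.block [.const 13 0, .const 6 0]) s 3 (LinkInv D 0 0) := by
    obtain ⟨a8, a11, a12⟩ := hf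
    refine .of_wp le_rfl ?_
    simp [wp, Prog.block]
    constructor <;> simp [*, Input.sumWeight, D.arcs_zero]
    · exact ArcLists.empty _ _ _
    · exact IsMate.empty
  refine (h1.seq fun s' hs' => Achieves.while_count (fun j s => LinkInv D j 0 s) D.m
    (fun j => 27 * D.ws j + 13) ?_ ?_ hs').mono ?_ ?_
  · intro j s hj hs
    refine ⟨?_, edge_step hD hj hs⟩
    simp [Test.Holds, hs.r6, hs.offsets.ready.r0, hj]
  · intro s hs
    simp [Test.Holds, hs.r6, hs.offsets.ready.r0]
  · rw [Finset.sum_add_distrib, Finset.sum_add_distrib, ← Finset.mul_sum]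
    simp [Input.sumWeight]; omega
  · rintro s ⟨ho, r6, r13, a12, hl, hm⟩
    exact ⟨a12, ⟨s.arr 8, s.arr 9, s.arr 14, s.arr 10, s.arr 11⟩, ⟨by simpa using hl, hm⟩,
      ⟨ho, rfl, rfl, rfl, rfl, rfl⟩⟩

end RAM

/-! ### The breadth-first search and the output -/

namespace RAM

variable {D : Input} {B : ℕ} {s : State} {L : Links}

theorem Input.Valid.arcs_lt (hD : D.Valid B) {φ : ℕ → Prop} {a b : ℕ}
    (h : (a, b) ∈ D.arcs φ D.m 0) : a < D.size ∧ b < D.size := by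
  obtain ⟨i, u, -, (⟨hi, hu⟩ | ⟨-, hu⟩), he⟩ := h
  · have h1 := hD.fst_lt hi
    have h2 := hD.snd_lt hi
    simp only [Prod.mk.injEq, Input.fstEnd, Input.sndEnd] at he
    omega
  · omega

/-- The queue and the marks of the search, in the arrays `12` and `13`. -/
structure Searching (D : Input) (L : Links) (s : State) : Prop where
  linked : Linked D L s
  queue : QueueInv D.size (D.arcs (fun _ => True) D.m 0) (D.arcs (fun j => D.mark j = 1) D.m 0)
    (s.arr 12) (s.arr 13) (s.reg 18)

def queueBody : Prog := .block
  [.load 9 11 6, .ite (.eq 9 3) (.block [.store 12 6 4, .store 13 18 6, .add 18 18 4]) .skip,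
   .add 6 6 4]

/-- Puts the unmatched nodes into the queue. -/
def queueProg : Prog :=
  .seq (.block [.const 18 0, .const 6 0]) (.while (.lt 6 14) queueBody)

theorem queue_spec (hD : D.Valid B) (hL : L.Rep D) (hs : Linked D L s)
    (h12 : s.arr 12 = fun _ => 0) :
    Achieves B queueProg s (9 * D.size + 4)
      fun s => Searching D L s ∧ ∀ a < D.size, L.mate a = 0 → s.arr 12 a = 1 := by
  have h1 : Achieves B (.block [.const 18 0, .const 6 0]) s 3 fun s => s.reg 6 = 0 ∧
      Searching D L s ∧ (∀ i < s.reg 18, s.arr 13 i < 0) ∧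
      ∀ a < 0, L.mate a = 0 → s.arr 12 a = 1 := by
    refine .of_wp le_rfl ?_
    simp [wp, Prog.block]
    constructor <;> simp [*]
    exact QueueInv.empty _ _ _ _
  refine (h1.seq fun s' hs' => Achieves.while_count (fun j s => s.reg 6 = j ∧ Searching D L s ∧
    (∀ i < s.reg 18, s.arr 13 i < j) ∧ ∀ a < j, L.mate a = 0 → s.arr 12 a = 1) D.size
    (fun _ => 8) ?_ ?_ hs').mono ?_ fun s h => ⟨h.2.1, h.2.2.2⟩
  · rintro j s hj ⟨h6, ⟨hs, hq⟩, hlt, hg⟩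
    have ⟨ho, a8, a9, a14, a10, a11⟩ := hs
    have ⟨hr, r14, a7⟩ := ho
    have ⟨r0, r1, r2, r3, r4, r5, a0, a1, a2, a3⟩ := hr
    have b1 := hD.size_le
    refine ⟨by simp [Test.Holds, *], .of_wp (by decide) ?_⟩
    simp [wp, queueBody, Prog.block, Test.Holds, *]
    refine ⟨fun h0 => ?_, fun h0 => ⟨by omega, ?_, fun i hi => (hlt i hi).le, fun a ha h => ?_⟩⟩
    · have hf : Found D.size (D.arcs (fun _ => True) D.m 0)
          (D.arcs (fun j => D.mark j = 1) D.m 0) j :=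
        .base hj fun b hb => hL.mate.complete j b hb h0
      -- All entries so far are below `j`, so `j` cannot be marked yet and may be pushed.
      rcases hq.good_or j with h2 | ⟨h2, i, hi, h3⟩
      · have hp := hq.push hj hf h2
        have := hp.le
        refine ⟨by omega, by omega, ?_, fun i hi => ?_, fun a ha h => ?_⟩
        · constructor <;> simp [*]
        · rcases eq_or_ne i (s.reg 18) with rfl | hne
          · simp
          · rw [Function.update_of_ne hne]
            exact (hlt i (by omega)).le
        · rcases eq_or_ne a j with rfl | hne
          · simp
          · rw [Function.update_of_ne hne]
            exact hg a (by omega) h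
      · exact absurd (h3 ▸ hlt i hi) (lt_irrefl _)
    · constructor <;> simp [*]
    · rcases eq_or_ne a j with rfl | hne
      · exact absurd h h0
      · exact hg a (by omega) h
  · rintro s ⟨h6, ⟨⟨⟨-, h14, -⟩, -, -, -, -⟩, -⟩, -⟩
    simp [Test.Holds, *]
  · simp; omega

/-- Register `19` points to an arc out of the current copy. If its target is matched and the mate is
unmarked, the mate is marked and appended at the tail in register `18`. -/
def scanBody : Prog := .block
  [.load 12 10 19, .load 11 11 12,
   .ite (.lt 3 11) (.block [.sub 11 11 4, .load 9 12 11,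
     .ite (.eq 9 3) (.block [.store 12 11 4, .store 13 18 11, .add 18 18 4]) .skip]) .skip,
   .load 19 9 19]

/-- The invariant of the scan of the arcs that leave the queue entry number `h`. The queue
entries before are given by `Q`. -/
structure ScanInv (D : Input) (L : Links) (Q : ℕ → ℕ) (h : ℕ) (s : State) : Prop
    extends Searching D L s where
  r17 : s.reg 17 = h + 1
  h_lt : h < s.reg 18
  base : ∀ a < D.size, L.mate a = 0 → s.arr 12 a = 1
  prefix_eq : ∀ i ≤ h, s.arr 13 i = Q i
  ptr : s.reg 19 = 0 ∨ 1 ≤ s.reg 19 ∧ s.reg 19 ≤ 2 * D.sumWeight D.m ∧ L.src (s.reg 19) = Q h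
  closed : ∀ k, 1 ≤ k → k ≤ 2 * D.sumWeight D.m →
    ((∃ i < h, Q i = L.src k) ∨ (L.src k = Q h ∧ s.reg 19 < k)) → L.mate (L.dst k) ≠ 0 →
      s.arr 12 (L.mate (L.dst k) - 1) = 1

theorem scan_step (hD : D.Valid B) (hL : L.Rep D) {Q : ℕ → ℕ} {h : ℕ}
    (hs : ScanInv D L Q h s) (h0 : s.reg 19 ≠ 0) :
    Achieves B scanBody s 15
      fun s' => ScanInv D L Q h s' ∧ s'.reg 19 = L.nxt (s.reg 19) := by
  obtain ⟨⟨hs, hq⟩, r17, h_lt, base, hQ, ptr, closed⟩ := hs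
  have ⟨ho, a8, a9, a14, a10, a11⟩ := hs
  have ⟨hr, r14, a7⟩ := ho
  have ⟨r0, r1, r2, r3, r4, r5, a0, a1, a2, a3⟩ := hr
  have b1 := hD.size_le
  obtain ⟨k1, k2, k3⟩ := ptr.resolve_left h0
  generalize hk : s.reg 19 = k at *
  have hnlt := hL.lists.nxt_lt k k1 k2
  have hptr : L.nxt k = 0 ∨ 1 ≤ L.nxt k ∧ L.nxt k ≤ 2 * D.sumWeight D.m ∧
      L.src (L.nxt k) = Q h := by
    rcases Nat.eq_zero_or_pos (L.nxt k) with h1 | h1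
    · exact Or.inl h1
    · exact Or.inr ⟨h1, by omega, by rw [hL.lists.src_nxt k k1 k2 (by omega), k3]⟩
  -- Lists are decreasing, so the arcs already scanned are those above the pointer, and moving from
  -- `k` to its successor adds only `k`. Marks are never removed, so the earlier arcs stay settled.
  have hcl : ∀ good : ℕ → ℕ, (∀ a, s.arr 12 a = 1 → good a = 1) →
      (L.mate (L.dst k) ≠ 0 → good (L.mate (L.dst k) - 1) = 1) →
      ∀ k', 1 ≤ k' → k' ≤ 2 * D.sumWeight D.m →
      ((∃ i < h, Q i = L.src k') ∨ (L.src k' = Q h ∧ L.nxt k < k')) → L.mate (L.dst k') ≠ 0 →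
      good (L.mate (L.dst k') - 1) = 1 := by
    intro good hmono hgk k' h1 h2 h3 h4
    rcases eq_or_ne k' k with rfl | hne
    · exact hgk h4
    · refine hmono _ (closed k' h1 h2 (h3.imp_right fun h5 => ⟨h5.1, ?_⟩) h4)
      by_contra h6
      have := hL.lists.le_nxt k k1 k2 k' h1 (by omega) (h5.1.trans k3.symm)
      omega
  refine .of_wp (by decide) ?_
  by_cases hm : L.mate (L.dst k) = 0
  · simp [wp, scanBody, Prog.block, Test.Holds, *]
    constructor <;> try simp [*]
    · constructor <;> simp [*]
    · exact base
    · exact hQ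
    · exact hcl _ (fun _ => id) (fun h => absurd hm h)
  have hT := hL.mate.sound _ hm
  have hlt := (hD.arcs_lt hT).2
  rcases hq.good_or (L.mate (L.dst k) - 1) with hg | ⟨hg, -⟩
  · have hf : Found D.size (D.arcs (fun _ => True) D.m 0)
          (D.arcs (fun j => D.mark j = 1) D.m 0) (L.mate (L.dst k) - 1) := by
      refine .step (hq.found h h_lt) ?_ hT
      rw [hQ h le_rfl, ← k3]
      exact hL.lists.sound k k1 k2
    have hp := hq.push hlt hf hg
    have := hp.le
    simp [wp, scanBody, Prog.block, Test.Holds, *]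
    refine fun _ => ⟨by omega, ?_⟩
    have hmono : ∀ a, s.arr 12 a = 1 →
        Function.update (s.arr 12) (L.mate (L.dst k) - 1) 1 a = 1 := by
      intro a ha
      rw [Function.update_apply]
      split_ifs <;> simp [*]
    constructor <;> try simp [*]
    · constructor <;> simp [*]
    · omega
    · exact fun a ha h => hmono a (base a ha h)
    · intro i hi
      rw [Function.update_of_ne (by omega), hQ i hi]
    · exact hcl _ hmono (fun _ => by simp)
  · simp [wp, scanBody, Prog.block, Test.Holds, *]
    intro _
    constructor <;> try simp [*]
    · constructor <;> simp [*]
    · exact base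
    · exact hQ
    · exact hcl _ (fun _ => id) (fun _ => hg)

def popProg : Prog :=
  .seq (.block [.load 7 13 17, .add 17 17 4, .load 19 8 7]) (.while (.lt 3 19) scanBody)

/-- The search from the nodes in the queue. -/
def searchProg : Prog := .seq (.const 17 0) (.while (.lt 17 18) popProg)

/-- The invariant of the search, when `h` queue entries are processed. -/
structure SearchInv (D : Input) (L : Links) (h : ℕ) (s : State) : Prop
    extends Searching D L s where
  r17 : s.reg 17 = h
  h_le : h ≤ s.reg 18
  base : ∀ a < D.size, L.mate a = 0 → s.arr 12 a = 1
  closed : ∀ k, 1 ≤ k → k ≤ 2 * D.sumWeight D.m → (∃ i < h, s.arr 13 i = L.src k) →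
    L.mate (L.dst k) ≠ 0 → s.arr 12 (L.mate (L.dst k) - 1) = 1

/-- The arcs from `a` that have at most the number `k`. -/
def Links.arcsFrom (L : Links) (a k : ℕ) : Finset ℕ := {i ∈ Finset.Icc 1 k | L.src i = a}

/-- Every scan costs at most `15` steps and a test, paid by the arc it leaves behind. New entries go
behind position `h`, so the processed part of the queue is unchanged. -/
theorem pop_step (hD : D.Valid B) (hL : L.Rep D) {h : ℕ} (hs : SearchInv D L h s)
    (hlt : h < s.reg 18) :
    Achieves B popProg s (16 * (L.arcsFrom (s.arr 13 h) (2 * D.sumWeight D.m)).card + 5)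
      fun s' => SearchInv D L (h + 1) s' ∧ ∀ i ≤ h, s'.arr 13 i = s.arr 13 i := by
  have h1 : Achieves B (.block [.load 7 13 17, .add 17 17 4, .load 19 8 7]) s 4
      fun s' => s'.reg 19 ≤ 2 * D.sumWeight D.m ∧ ScanInv D L (s.arr 13) h s' := by
    obtain ⟨⟨hs, hq⟩, r17, h_le, base, closed⟩ := hs
    have ⟨ho, a8, a9, a14, a10, a11⟩ := hs
    have ⟨hr, r14, a7⟩ := ho
    have ⟨r0, r1, r2, r3, r4, r5, a0, a1, a2, a3⟩ := hr
    have b1 := hD.size_le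
    have b2 := hq.le
    have b3 := hL.lists.head_le (s.arr 13 h)
    refine .of_wp (by decide) ?_
    simp [wp, Prog.block, *]
    refine ⟨by omega, ?_⟩
    constructor <;> try simp [*]
    · constructor <;> simp [*]
    · exact base
    · rcases Nat.eq_zero_or_pos (L.head (s.arr 13 h)) with h1 | h1
      · exact Or.inl h1
      · exact Or.inr ⟨h1, hL.lists.src_head _ (by omega)⟩
    · intro k k1 k2 k3 k4
      refine closed k k1 k2 ?_ k4
      rcases k3 with k3 | ⟨k3, k5⟩
      · exact k3
      · have := hL.lists.le_head k k1 k2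
        rw [k3] at this
        omega
  refine (h1.seq (T₂ := 16 * (L.arcsFrom (s.arr 13 h) (2 * D.sumWeight D.m)).card + 1)
    fun s' hs' => (Achieves.while_potential (fun n s' => ScanInv D L (s.arr 13) h s' ∧
    n = 16 * (L.arcsFrom (s.arr 13 h) (s'.reg 19)).card) ?_ _ s' ⟨hs'.2, rfl⟩).mono
    ?_ ?_).mono (by omega) fun s' => id
  · rintro n s' ⟨hs', rfl⟩ ht
    have h0 : s'.reg 19 ≠ 0 := by
      simp only [Test.Holds, hs'.linked.offsets.ready.r3] at ht
      omega
    refine ⟨15, (scan_step hD hL hs' h0).mono le_rfl ?_⟩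
    rintro s'' ⟨hs'', hn⟩
    refine ⟨_, ?_, hs'', rfl⟩
    obtain ⟨k1, k2, k3⟩ := hs'.ptr.resolve_left h0
    have := hL.lists.nxt_lt _ k1 k2
    have : (L.arcsFrom (s.arr 13 h) (s''.reg 19)).card <
        (L.arcsFrom (s.arr 13 h) (s'.reg 19)).card := by
      refine Finset.card_lt_card ((Finset.ssubset_iff_of_subset ?_).2 ⟨s'.reg 19, ?_, ?_⟩)
      · intro i hi
        simp only [Links.arcsFrom, Finset.mem_filter, Finset.mem_Icc] at hi ⊢
        exact ⟨⟨hi.1.1, by omega⟩, hi.2⟩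
      · simp only [Links.arcsFrom, Finset.mem_filter, Finset.mem_Icc]
        exact ⟨⟨k1, le_rfl⟩, k3⟩
      · simp only [Links.arcsFrom, Finset.mem_filter, Finset.mem_Icc]
        omega
    omega
  · have : (L.arcsFrom (s.arr 13 h) (s'.reg 19)).card ≤
        (L.arcsFrom (s.arr 13 h) (2 * D.sumWeight D.m)).card := by
      refine Finset.card_le_card fun i hi => ?_
      simp only [Links.arcsFrom, Finset.mem_filter, Finset.mem_Icc] at hi ⊢
      exact ⟨⟨hi.1.1, by omega⟩, hi.2⟩
    omega
  · rintro s'' ⟨⟨_, ⟨hq, r17, h_lt, base, hQ, ptr, closed⟩, -⟩, ht⟩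
    refine ⟨⟨hq, r17, h_lt, base, fun k k1 k2 k3 k4 => closed k k1 k2 ?_ k4⟩, hQ⟩
    obtain ⟨i, hi, k3⟩ := k3
    rw [hQ i (by omega)] at k3
    rcases Nat.lt_or_ge i h with h2 | h2
    · exact Or.inl ⟨i, h2, k3⟩
    · obtain rfl : i = h := by omega
      refine Or.inr ⟨k3.symm, ?_⟩
      have h3 : s''.reg 3 = 0 := hq.linked.offsets.ready.r3
      simp only [Test.Holds, h3] at ht
      omega

/-- The arcs that leave none of the first `h` queue entries. -/
def Links.arcsLeft (L : Links) (D : Input) (Q : ℕ → ℕ) (h : ℕ) : Finset ℕ :=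
  {k ∈ Finset.Icc 1 (2 * D.sumWeight D.m) | ∀ i < h, Q i ≠ L.src k}

/-- As the entries are distinct, the arcs out of `Q h` were not paid for earlier; this makes the
cost of the search linear in the number of arcs. -/
theorem Links.card_arcsLeft_succ {Q Q' : ℕ → ℕ} {h : ℕ} (hQ : ∀ i ≤ h, Q' i = Q i)
    (hne : ∀ i < h, Q i ≠ Q h) : (L.arcsLeft D Q' (h + 1)).card +
      (L.arcsFrom (Q h) (2 * D.sumWeight D.m)).card ≤ (L.arcsLeft D Q h).card := by
  rw [← Finset.card_union_of_disjoint]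
  · refine Finset.card_le_card fun k hk => ?_
    simp only [arcsLeft, arcsFrom, Finset.mem_union, Finset.mem_filter] at hk ⊢
    rcases hk with ⟨h1, h2⟩ | ⟨h1, h2⟩
    · exact ⟨h1, fun i hi => hQ i (by omega) ▸ h2 i (by omega)⟩
    · exact ⟨h1, fun i hi => h2 ▸ hne i hi⟩
  · refine Finset.disjoint_left.2 fun k hk hk' => ?_
    simp only [arcsLeft, arcsFrom, Finset.mem_filter] at hk hk'
    exact hk.2 h (by omega) ((hQ h le_rfl).trans hk'.2.symm)

theorem search_spec (hD : D.Valid B) (hL : L.Rep D)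
    (huniq : ∀ a b c, (a, b) ∈ D.arcs (fun j => D.mark j = 1) D.m 0 →
      (a, c) ∈ D.arcs (fun j => D.mark j = 1) D.m 0 → b = c)
    (hs : Searching D L s) (hb : ∀ a < D.size, L.mate a = 0 → s.arr 12 a = 1) :
    Achieves B searchProg s (32 * D.sumWeight D.m + 6 * D.size + 2) fun s => Linked D L s ∧
      (∀ a, s.arr 12 a = 0 ∨ s.arr 12 a = 1) ∧ ∀ a, s.arr 12 a = 1 ↔
        Found D.size (D.arcs (fun _ => True) D.m 0) (D.arcs (fun j => D.mark j = 1) D.m 0) a := by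
  have h1 : Achieves B (.const 17 0) s 1 fun s => SearchInv D L 0 s := by
    obtain ⟨hs, hq⟩ := hs
    refine .of_wp le_rfl ?_
    simp [wp]
    constructor <;> try simp [*]
    · constructor <;> simp [*]
    · exact hb
  -- The potential charges `16` for each of at most `2W` remaining arcs and `6` for each possible
  -- remaining pop: `5` for its overhead and one for the outer test.
  refine (h1.seq (T₂ := 32 * D.sumWeight D.m + 6 * D.size + 1)
    fun s' hs' => (Achieves.while_potential (fun n s' => ∃ h, SearchInv D L h s' ∧
    n = 16 * (L.arcsLeft D (s'.arr 13) h).card + 6 * (D.size - h)) ?_ _ s' ⟨0, hs', rfl⟩).mono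
    ?_ ?_).mono (by omega) fun s' => id
  · rintro n s ⟨h, hs, rfl⟩ ht
    have hlt : h < s.reg 18 := by simpa [Test.Holds, hs.r17] using ht
    refine ⟨_, (pop_step hD hL hs hlt).mono le_rfl ?_⟩
    rintro s' ⟨hs', hQ⟩
    refine ⟨_, ?_, h + 1, hs', rfl⟩
    have h2 := Links.card_arcsLeft_succ (D := D) (L := L) hQ fun i hi h3 =>
      absurd (hs.queue.inj i (by omega) h hlt h3) (by omega)
    have h3 := hs.queue.le
    omega
  · have : (L.arcsLeft D (s'.arr 13) 0).card ≤ 2 * D.sumWeight D.m := by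
      refine (Finset.card_filter_le _ _).trans ?_
      simp
    omega
  · rintro s' ⟨⟨_, h, ⟨⟨hs, hq⟩, r17, h_le, base, closed⟩, -⟩, ht⟩
    simp only [Test.Holds, r17, not_lt] at ht
    -- The whole queue is processed, so `closed` speaks of all entries and `good_iff` applies.
    obtain rfl : h = s'.reg 18 := by omega
    exact ⟨hs, fun a => (hq.good_or a).imp_right And.left,
      hq.good_iff hL.lists hL.mate huniq base closed⟩

def outBody (A r : ℕ) : Prog := .block [.load 10 12 6, .sub 10 4 10, .store A r 10, .add 6 6 4]

/-- Writes the results into the arrays `4` and `5`. -/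
def outProg : Prog :=
  .seq (.block [.load 9 7 1, .const 6 0, .const 8 0])
  (.seq (.while (.lt 6 9) (outBody 4 6))
    (.while (.lt 6 14) (.seq (outBody 5 8) (.add 8 8 4))))

theorem out_spec (hD : D.Valid B) (hs : Linked D L s) :
    Achieves B outProg s (8 * D.size + 8) fun s' =>
      (∀ i < D.off D.p, s'.arr 4 i = 1 - s.arr 12 i) ∧
      ∀ i, D.off D.p + i < D.size → s'.arr 5 i = 1 - s.arr 12 (D.off D.p + i) := by
  have hp := D.off_mono (show D.p ≤ D.p + D.q by omega)
  have b1 := hD.size_le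
  generalize hg : s.arr 12 = good
  have h1 : Achieves B (.block [.load 9 7 1, .const 6 0, .const 8 0]) s 4 fun s =>
      s.reg 6 = 0 ∧ s.reg 8 = 0 ∧ s.reg 9 = D.off D.p ∧ Linked D L s ∧ s.arr 12 = good ∧
      ∀ i < 0, s.arr 4 i = 1 - good i := by
    have ⟨⟨⟨r0, r1, r2, r3, r4, r5, a0, a1, a2, a3⟩, r14, a7⟩, a8, a9, a14, a10, a11⟩ := hs
    refine .of_wp (by decide) ?_
    simp [wp, Prog.block, *]
  refine (h1.seq fun s' hs' => (Achieves.while_count (fun j s => s.reg 6 = j ∧ s.reg 8 = 0 ∧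
    s.reg 9 = D.off D.p ∧ Linked D L s ∧ s.arr 12 = good ∧ ∀ i < j, s.arr 4 i = 1 - good i)
    (D.off D.p) (fun _ => 5) ?_ ?_ hs').seq fun s' hs' =>
      (Achieves.while_count (fun j s => s.reg 6 = D.off D.p + j ∧ s.reg 8 = j ∧
    Linked D L s ∧ s.arr 12 = good ∧ (∀ i < D.off D.p, s.arr 4 i = 1 - good i) ∧
      ∀ i < j, s.arr 5 i = 1 - good (D.off D.p + i))
    (D.size - D.off D.p) (fun _ => 6) ?_ ?_ ?_)).mono ?_ ?_
  · rintro j s hj ⟨r6, r8, r9, hs, a12, a4⟩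
    have ⟨⟨⟨r0, r1, r2, r3, r4, r5, a0, a1, a2, a3⟩, r14, a7⟩, a8, a9, a14, a10, a11⟩ := hs
    refine ⟨by simp [Test.Holds, *], .of_wp (by decide) ?_⟩
    simp [wp, outBody, Prog.block, *]
    refine ⟨by unfold Input.size at b1; omega, fun i hi => ?_⟩
    rcases eq_or_ne i j with rfl | hne
    · simp
    · rw [Function.update_of_ne hne, a4 i (by omega)]
  · rintro s ⟨r6, -, r9, -⟩
    simp [Test.Holds, *]
  · rintro j s hj ⟨r6, r8, hs, a12, a4, a5⟩
    have ⟨⟨⟨r0, r1, r2, r3, r4, r5, a0, a1, a2, a3⟩, r14, a7⟩, a8, a9, a14, a10, a11⟩ := hs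
    refine ⟨by simp [Test.Holds, *]; omega, .of_wp (by decide) ?_⟩
    simp [wp, outBody, Prog.block, *]
    refine ⟨by omega, by omega, rfl, a4, fun i hi => ?_⟩
    rcases eq_or_ne i j with rfl | hne
    · simp
    · rw [Function.update_of_ne hne, a5 i (by omega)]
  · rintro s ⟨r6, r8, hs, -⟩
    simp [Test.Holds, hs.offsets.r14, *]
    unfold Input.size
    omega
  · obtain ⟨r6, r8, r9, hs, a12, a4⟩ := hs'
    exact ⟨r6, r8, hs, a12, a4, by simp⟩
  · simp
    unfold Input.size at *
    omega
  · rintro s ⟨-, -, -, -, a4, a5⟩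
    exact ⟨a4, fun i hi => a5 i (by omega)⟩

/-- The whole program. -/
def rhoProg : Prog :=
  .seq (.block [.const 3 0, .const 4 1, .add 5 1 2])
  (.seq maxWeightProg (.seq offsetProg (.seq linkProg (.seq queueProg (.seq searchProg outProg)))))

theorem rhoProg_spec (hD : D.Valid B)
    (huniq : ∀ a b c, (a, b) ∈ D.arcs (fun j => D.mark j = 1) D.m 0 →
      (a, c) ∈ D.arcs (fun j => D.mark j = 1) D.m 0 → b = c)
    (hreg : s.reg 0 = D.m ∧ s.reg 1 = D.p ∧ s.reg 2 = D.q)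
    (harr : s.arr 0 = D.xs ∧ s.arr 1 = D.ys ∧ s.arr 2 = D.ws ∧ s.arr 3 = D.mark)
    (hzero : ∀ A, 6 ≤ A → s.arr A = fun _ => 0) :
    Achieves B rhoProg s (59 * D.sumWeight D.m + 34 * D.m + 6 * (D.p + D.q) + 23 * D.size + 29)
      fun s => ∃ good : ℕ → ℕ, (∀ a, good a = 0 ∨ good a = 1) ∧
      (∀ a, good a = 1 ↔ Found D.size (D.arcs (fun _ => True) D.m 0)
        (D.arcs (fun j => D.mark j = 1) D.m 0) a) ∧
      (∀ i < D.off D.p, s.arr 4 i = 1 - good i) ∧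
      ∀ i, D.off D.p + i < D.size → s.arr 5 i = 1 - good (D.off D.p + i) := by
  have h1 : Achieves B (.block [.const 3 0, .const 4 1, .add 5 1 2]) s 4 fun s =>
      D.Ready s ∧ Fresh s ∧ s.arr 6 = fun _ => 0 := by
    obtain ⟨r0, r1, r2⟩ := hreg
    obtain ⟨a0, a1, a2, a3⟩ := harr
    have := hD.one_le
    have := hD.pq_le
    refine .of_wp (by decide) ?_
    simp [wp, Prog.block, *]
    refine ⟨?_, ?_⟩
    · constructor <;> simp [*]
    · constructor <;> simp [*]
  refine (h1.seq fun s ⟨hr, hf, h6⟩ => (maxWeight_spec hD hr hf h6).seq fun s ⟨hr, hf, h6⟩ =>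
    (offset_spec hD hr hf h6).seq fun s ⟨ho, hf⟩ => (link_spec hD ho hf).seq
    -- The joint cost of filling the queue, searching and writing the output.
    (T₂ := 32 * D.sumWeight D.m + 23 * D.size + 14) fun s ⟨h12, L, hL, hs⟩ =>
    ((queue_spec hD hL hs h12).seq fun s ⟨hs, hb⟩ => (search_spec hD hL huniq hs hb).seq
    fun s ⟨hs, h01, hf⟩ => (out_spec hD hs).mono le_rfl
    fun s' ⟨h4, h5⟩ => ⟨s.arr 12, h01, hf, h4, h5⟩).mono ?_ fun _ => id).mono ?_ fun _ => id
  · omega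
  · omega

end RAM

/-! ### From the numbered data back to the graph -/

namespace WBGraph

open RAM SimpleGraph

variable {p q : ℕ} {G : WBGraph (Fin p) (Fin q)} {l : List (Fin p × Fin q)}
  {M : Finset (Fin p × Fin q)}

/-- The data in the initial state. -/
def input (G : WBGraph (Fin p) (Fin q)) (l : List (Fin p × Fin q)) (M : Finset (Fin p × Fin q)) :
    Input where
  m := l.length
  p := p
  q := q
  xs := (G.inputState l M).arr 0
  ys := (G.inputState l M).arr 1
  ws := (G.inputState l M).arr 2
  mark := (G.inputState l M).arr 3

theorem input_xs {j : ℕ} (hj : j < l.length) : (G.input l M).xs j = l[j].1 := by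
  simp [input, inputState, hj]

theorem input_ys {j : ℕ} (hj : j < l.length) : (G.input l M).ys j = l[j].2 := by
  simp [input, inputState, hj]

theorem input_ws {j : ℕ} (hj : j < l.length) : (G.input l M).ws j = G.w l[j].1 l[j].2 := by
  simp [input, inputState, hj]

theorem input_mark {j : ℕ} (hj : j < l.length) :
    (G.input l M).mark j = 1 ↔ l[j] ∈ M := by
  simp [input, inputState, hj]

/-- The index of a node. -/
def nodeIndex : Fin p ⊕ Fin q → ℕ := Sum.elim (fun x => x) fun y => y + p

theorem nodeIndex_lt (u : Fin p ⊕ Fin q) : nodeIndex u < p + q := by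
  rcases u with x | y <;> simp [nodeIndex] <;> omega

theorem nodeIndex_injective : Function.Injective (nodeIndex : Fin p ⊕ Fin q → ℕ) := by
  rintro (x | y) (x' | y') h <;> simp [nodeIndex] at h ⊢ <;> omega

/-- Pairs that are not listed have weight `0` and do not affect the maximum. -/
theorem maxWeight_nodeIndex (hl : G.IsEdgeList l) (u : Fin p ⊕ Fin q) :
    (G.input l M).maxWeight l.length (nodeIndex u) = G.numCopies u := by
  apply le_antisymm
  · refine Finset.sup_le fun j hj => ?_
    have hj := Finset.mem_range.1 hj
    rw [input_xs hj, input_ys hj, input_ws hj]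
    split_ifs with h
    · rcases u with x | y
      · obtain h | h := h
        · have : l[j].1 = x := Fin.ext h
          rw [this]; exact G.w_le_numCopies_inl _ _
        · simp [nodeIndex, input] at h
          omega
      · obtain h | h := h
        · simp [nodeIndex] at h
          omega
        · simp [nodeIndex, input] at h
          have : l[j].2 = y := Fin.ext h
          rw [this]; exact G.w_le_numCopies_inr _ _
    · exact Nat.zero_le _
  · have key : ∀ (x : Fin p) (y : Fin q), nodeIndex (.inl x : Fin p ⊕ Fin q) = nodeIndex u ∨
        nodeIndex (.inr y : Fin p ⊕ Fin q) = nodeIndex u →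
        G.w x y ≤ (G.input l M).maxWeight l.length (nodeIndex u) := by
      intro x y h
      rcases Nat.eq_zero_or_pos (G.w x y) with h0 | h0
      · omega
      obtain ⟨j, hj, he⟩ := List.getElem_of_mem ((hl.2 (x, y)).2 h0)
      have := Finset.le_sup (f := fun i => if (G.input l M).xs i = nodeIndex u ∨
        (G.input l M).ys i + (G.input l M).p = nodeIndex u then (G.input l M).ws i else 0)
        (Finset.mem_range.2 hj)
      rw [input_xs hj, input_ys hj, input_ws hj, he] at this
      have h' : ((x, y).1 : ℕ) = nodeIndex u ∨ ((x, y).2 : ℕ) + (G.input l M).p = nodeIndex u := h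
      rwa [if_pos h'] at this
    rcases u with x | y
    · exact Finset.sup_le fun y _ => key x y (Or.inl rfl)
    · exact Finset.sup_le fun x _ => key x y (Or.inr rfl)

theorem off_inl (hl : G.IsEdgeList l) (x : Fin p) :
    (G.input l M).off x = ∑ x' ∈ Finset.Iio x, G.numCopies (.inl x') := by
  have : ∀ x' ∈ Finset.Iio x, G.numCopies (.inl x') =
      (G.input l M).maxWeight l.length (Fin.valEmbedding x') := fun x' _ =>
    (maxWeight_nodeIndex hl (.inl x')).symm
  rw [Finset.sum_congr rfl this, ← Finset.sum_map (Finset.Iio x) Fin.valEmbedding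
    (fun i => (G.input l M).maxWeight l.length i), Fin.map_valEmbedding_Iio]
  rw [Input.off, Nat.Iio_eq_range]
  rfl

theorem off_inr (hl : G.IsEdgeList l) (y : Fin q) :
    (G.input l M).off (y + p) =
      (G.input l M).off p + ∑ y' ∈ Finset.Iio y, G.numCopies (.inr y') := by
  have : ∀ y' ∈ Finset.Iio y, G.numCopies (.inr y') =
      (G.input l M).maxWeight l.length (p + Fin.valEmbedding y') := fun y' _ => by
    rw [add_comm]; exact (maxWeight_nodeIndex hl (.inr y')).symm
  rw [Finset.sum_congr rfl this, ← Finset.sum_map (Finset.Iio y) Fin.valEmbedding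
    (fun i => (G.input l M).maxWeight l.length (p + i)), Fin.map_valEmbedding_Iio]
  rw [Input.off, add_comm, Finset.sum_range_add, Nat.Iio_eq_range]
  rfl

theorem size_eq (hl : G.IsEdgeList l) : (G.input l M).size =
    ∑ x, G.numCopies (.inl x) + ∑ y, G.numCopies (.inr y) := by
  have h1 : ∀ x : Fin p, G.numCopies (.inl x) = (G.input l M).maxWeight l.length x :=
    fun x => (maxWeight_nodeIndex hl (.inl x)).symm
  have h2 : ∀ y : Fin q, G.numCopies (.inr y) = (G.input l M).maxWeight l.length (p + y) :=
    fun y => by rw [add_comm]; exact (maxWeight_nodeIndex hl (.inr y)).symm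
  rw [Input.size, Input.off]
  change ∑ i ∈ Finset.range (p + q), (G.input l M).maxWeight l.length i = _
  rw [Finset.sum_range_add, Finset.sum_range, Finset.sum_range]
  simp only [h1, h2]

/-- The heaviest weight at a node is at most the sum of the weights there, and each edge counts at
two nodes. -/
theorem size_le (hl : G.IsEdgeList l) : (G.input l M).size ≤ 2 * G.totalWeight := by
  rw [size_eq hl, two_mul]
  refine add_le_add ?_ ?_
  · refine Finset.sum_le_sum fun x _ => Finset.sup_le fun y _ => ?_
    exact Finset.single_le_sum (f := fun y => G.w x y) (fun _ _ => Nat.zero_le _)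
      (Finset.mem_univ y)
  · rw [totalWeight, Finset.sum_comm]
    refine Finset.sum_le_sum fun y _ => Finset.sup_le fun x _ => ?_
    exact Finset.single_le_sum (f := fun x => G.w x y) (fun _ _ => Nat.zero_le _)
      (Finset.mem_univ x)

theorem sumWeight_eq (hl : G.IsEdgeList l) :
    (G.input l M).sumWeight l.length = G.totalWeight := by
  have h1 : (G.input l M).sumWeight l.length = (l.map fun e => G.w e.1 e.2).sum := by
    rw [Input.sumWeight, Finset.sum_range, ← Fin.sum_univ_fun_getElem l fun e => G.w e.1 e.2]
    exact Finset.sum_congr rfl fun j _ => input_ws j.2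
  rw [h1, ← List.sum_toFinset _ hl.1, totalWeight, ← Fintype.sum_prod_type']
  refine Finset.sum_subset (Finset.subset_univ _) fun e _ he => ?_
  by_contra h0
  exact he (List.mem_toFinset.2 ((hl.2 e).2 (Nat.pos_of_ne_zero h0)))

theorem length_le (hl : G.IsEdgeList l) : l.length ≤ G.totalWeight := by
  rw [← sumWeight_eq (M := ∅) hl, Input.sumWeight]
  calc l.length = ∑ _i ∈ Finset.range l.length, 1 := by simp
    _ ≤ _ := Finset.sum_le_sum fun j hj => by
        have hj := Finset.mem_range.1 hj
        rw [input_ws hj]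
        exact (hl.2 _).1 (List.getElem_mem hj)

/-- The index of a copy. -/
def copyIndex (G : WBGraph (Fin p) (Fin q)) (l : List (Fin p × Fin q))
    (M : Finset (Fin p × Fin q)) (a : G.Copy) : ℕ :=
  (G.input l M).off (nodeIndex a.1) + a.2

theorem copyIndex_lt_off (hl : G.IsEdgeList l) (a : G.Copy) :
    G.copyIndex l M a < (G.input l M).off (nodeIndex a.1 + 1) := by
  have h := a.2.2.trans_eq (maxWeight_nodeIndex (M := M) hl a.1).symm
  rw [Input.off_succ]
  exact Nat.add_lt_add_left h _

theorem copyIndex_lt (hl : G.IsEdgeList l) (a : G.Copy) :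
    G.copyIndex l M a < (G.input l M).size :=
  (copyIndex_lt_off hl a).trans_le ((G.input l M).off_mono (nodeIndex_lt a.1))

/-- The copies of different nodes occupy disjoint intervals between consecutive offsets. -/
theorem copyIndex_injective (hl : G.IsEdgeList l) : Function.Injective (G.copyIndex l M) := by
  intro a b h
  have ha := copyIndex_lt_off (M := M) hl a
  have hb := copyIndex_lt_off (M := M) hl b
  have h1 : (G.input l M).off (nodeIndex a.1) ≤ G.copyIndex l M a := Nat.le_add_right _ _
  have h2 : (G.input l M).off (nodeIndex b.1) ≤ G.copyIndex l M b := Nat.le_add_right _ _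
  have h3 : nodeIndex a.1 = nodeIndex b.1 := by
    rcases lt_trichotomy (nodeIndex a.1) (nodeIndex b.1) with h3 | h3 | h3
    · have := (G.input l M).off_mono h3
      simp only [Nat.succ_eq_add_one] at this
      omega
    · exact h3
    · have := (G.input l M).off_mono h3
      simp only [Nat.succ_eq_add_one] at this
      omega
  rcases a with ⟨u, i⟩
  rcases b with ⟨v, j⟩
  obtain rfl := nodeIndex_injective h3
  congr 1
  exact Fin.ext (Nat.add_left_cancel h)

/-- The dictionary between numbered arcs and adjacency, needed once for all edges and once for `M`.
-/
theorem mem_arcs_iff {S : Set (Fin p × Fin q)} (hS : ∀ e ∈ S, e ∈ l) {φ : ℕ → Prop}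
    (hφ : ∀ (j : ℕ) (hj : j < l.length), φ j ↔ l[j] ∈ S) (i j : ℕ) :
    (i, j) ∈ (G.input l M).arcs φ l.length 0 ↔ ∃ a b, (G.unfoldEdges S).Adj a b ∧
      G.copyIndex l M a = i ∧ G.copyIndex l M b = j := by
  constructor
  · rintro ⟨k, u, hk, (⟨h1, h2⟩ | ⟨_, h2⟩), h3⟩
    swap
    · omega
    have h4 := (hφ k h1).1 hk
    rw [input_ws h1] at h2
    have h5 := G.w_le_numCopies_inl l[k].1 l[k].2
    have h6 := G.w_le_numCopies_inr l[k].1 l[k].2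
    let a : G.Copy := ⟨.inl l[k].1, u, by omega⟩
    let b : G.Copy := ⟨.inr l[k].2, G.w l[k].1 l[k].2 - 1 - u, by omega⟩
    have hab : (G.unfoldEdges S).Adj a b :=
      unfoldEdges_adj_inl.2 ⟨h4, by simp only; omega⟩
    have ha : G.copyIndex l M a = (G.input l M).fstEnd k u := by
      rw [Input.fstEnd, input_xs h1]; rfl
    have hb : G.copyIndex l M b = (G.input l M).sndEnd k u := by
      rw [Input.sndEnd, input_ys h1, input_ws h1]
      change (G.input l M).off (l[k].2 + p) + (G.w l[k].1 l[k].2 - 1 - u) =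
        (G.input l M).off (l[k].2 + p) + G.w l[k].1 l[k].2 - 1 - u
      omega
    rcases h3 with h3 | h3 <;> simp only [Prod.mk.injEq] at h3
    · exact ⟨a, b, hab, by omega, by omega⟩
    · exact ⟨b, a, hab.symm, by omega, by omega⟩
  · have key : ∀ (x : Fin p) (y : Fin q) (i : Fin (G.numCopies (.inl x)))
        (j : Fin (G.numCopies (.inr y))), (x, y) ∈ S → (i : ℕ) + j + 1 = G.w x y →
        ∃ k, φ k ∧ k < l.length ∧ (i : ℕ) < (G.input l M).ws k ∧
          (G.input l M).fstEnd k i = G.copyIndex l M ⟨.inl x, i⟩ ∧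
          (G.input l M).sndEnd k i = G.copyIndex l M ⟨.inr y, j⟩ := by
      intro x y i j hxy hij
      obtain ⟨k, hk, he⟩ := List.getElem_of_mem (hS _ hxy)
      refine ⟨k, (hφ k hk).2 (he ▸ hxy), hk, ?_, ?_, ?_⟩
      · rw [input_ws hk, he]
        simp only
        omega
      · rw [Input.fstEnd, input_xs hk, he]; rfl
      · rw [Input.sndEnd, input_ys hk, input_ws hk, he]
        change (G.input l M).off (y + p) + G.w x y - 1 - i = (G.input l M).off (y + p) + j
        omega
    rintro ⟨⟨x | y, i'⟩, ⟨x' | y', j'⟩, hab, rfl, rfl⟩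
    · exact (unfoldEdges_side hab rfl).elim
    · obtain ⟨h1, h2⟩ := unfoldEdges_adj_inl.1 hab
      obtain ⟨k, h3, h4, h5, h6, h7⟩ := key _ _ i' j' h1 h2
      exact ⟨k, i', h3, Or.inl ⟨h4, h5⟩, Or.inl (by rw [h6, h7])⟩
    · obtain ⟨h1, h2⟩ := unfoldEdges_adj_inr.1 hab
      obtain ⟨k, h3, h4, h5, h6, h7⟩ := key _ _ j' i' h1 h2
      exact ⟨k, j', h3, Or.inl ⟨h4, h5⟩, Or.inr (by rw [h6, h7])⟩
    · exact (unfoldEdges_side hab rfl).elim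

theorem mem_arcs_unfolded (hl : G.IsEdgeList l) (i j : ℕ) :
    (i, j) ∈ (G.input l M).arcs (fun _ => True) l.length 0 ↔ ∃ a b, G.unfolded.Adj a b ∧
      G.copyIndex l M a = i ∧ G.copyIndex l M b = j :=
  mem_arcs_iff (fun e he => (hl.2 e).2 he)
    (fun _ hj => iff_of_true trivial ((hl.2 _).1 (List.getElem_mem hj))) i j

theorem mem_arcs_matching (hl : G.IsEdgeList l) (hM : G.IsMatching M) (i j : ℕ) :
    (i, j) ∈ (G.input l M).arcs (fun j => (G.input l M).mark j = 1) l.length 0 ↔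
      ∃ a b, (G.unfoldedMatching M).Adj a b ∧ G.copyIndex l M a = i ∧ G.copyIndex l M b = j :=
  mem_arcs_iff (fun e he => (hl.2 e).2 (hM.1 e he)) (fun _ hj => input_mark hj) i j

/-- The search follows the steps of `EvenReach` backwards, which is harmless because arcs are
present in both directions. -/
theorem found_iff (hl : G.IsEdgeList l) (hM : G.IsMatching M) (a : G.Copy) :
    Found (G.input l M).size ((G.input l M).arcs (fun _ => True) l.length 0)
      ((G.input l M).arcs (fun j => (G.input l M).mark j = 1) l.length 0) (G.copyIndex l M a) ↔
      EvenReach G.unfolded (G.unfoldedMatching M) a := by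
  have hinj := copyIndex_injective (M := M) hl
  constructor
  · intro h
    generalize hi : G.copyIndex l M a = i at h
    induction h generalizing a with
    | base hlt hn =>
      refine .base fun b hb => hn _ ((mem_arcs_matching hl hM _ _).2 ⟨a, b, hb, hi, rfl⟩)
    | step hc hcb hba ih =>
      obtain ⟨c, b, hcb, h1, h2⟩ := (mem_arcs_unfolded hl _ _).1 hcb
      obtain ⟨b', a', hba, h3, h4⟩ := (mem_arcs_matching hl hM _ _).1 hba
      obtain rfl := hinj (h2.trans h3.symm)
      obtain rfl := hinj (hi.trans h4.symm)
      exact .step hba.symm hcb.symm (ih c h1)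
  · intro h
    induction h with
    | base hn =>
      refine .base (copyIndex_lt hl _) fun k hk => ?_
      obtain ⟨a', b, hab, h1, -⟩ := (mem_arcs_matching hl hM _ _).1 hk
      exact hn b (hinj h1 ▸ hab)
    | step hab hbc _ ih =>
      exact .step ih ((mem_arcs_unfolded hl _ _).2 ⟨_, _, hbc.symm, rfl, rfl⟩)
        ((mem_arcs_matching hl hM _ _).2 ⟨_, _, hab.symm, rfl, rfl⟩)

theorem exec_rhoProg {κ : ℕ} (hl : G.IsEdgeList l) (hn : 0 < p + q) (hκ : p + q ≤ κ * l.length)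
    (hM : G.IsMatching M) : ∃ (T : ℕ) (s : State),
      Exec ((200 + 6 * κ) * G.totalWeight) rhoProg (G.inputState l M) T s ∧
      T ≤ (200 + 6 * κ) * G.totalWeight ∧ G.HoldsRho M s := by
  have hlen := length_le hl
  -- A nonempty edge list gives `W ≥ 1`, which absorbs the additive constants. With `m ≤ W`, `size ≤
  -- 2W` and `n ≤ κW`, the step bound is at most `(168 + 6κ)W`.
  have hpos : 0 < l.length := by
    rcases Nat.eq_zero_or_pos l.length with h | h
    · rw [h] at hκ; omega
    · exact h
  have hκ' : p + q ≤ κ * G.totalWeight := hκ.trans (Nat.mul_le_mul_left _ hlen)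
  have hC : (200 + 6 * κ) * G.totalWeight = 200 * G.totalWeight + 6 * (κ * G.totalWeight) := by
    ring
  have hsum := sumWeight_eq (M := M) hl
  have hsize := size_le (M := M) hl
  have hD : (G.input l M).Valid ((200 + 6 * κ) * G.totalWeight) := by
    rw [hC]
    refine ⟨fun j hj => ?_, fun j hj => ?_, by omega, ?_, ?_, ?_, by omega⟩
    · rw [input_xs hj]; exact l[j].1.2
    · rw [input_ys hj]; exact l[j].2.2
    · change l.length ≤ _; omega
    · change p + q ≤ _; omega
    · change 2 * (G.input l M).sumWeight l.length ≤ _; omega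
  have huniq : ∀ i j k,
      (i, j) ∈ (G.input l M).arcs (fun j => (G.input l M).mark j = 1) l.length 0 →
      (i, k) ∈ (G.input l M).arcs (fun j => (G.input l M).mark j = 1) l.length 0 → j = k := by
    intro i j k h1 h2
    obtain ⟨a, b, hab, rfl, rfl⟩ := (mem_arcs_matching hl hM _ _).1 h1
    obtain ⟨a', c, hac, h3, rfl⟩ := (mem_arcs_matching hl hM _ _).1 h2
    obtain rfl := copyIndex_injective hl h3
    rw [hM.unfoldedMatching_unique hab hac]
  obtain ⟨T, s, he, hT, good, h01, hg, h4, h5⟩ := rhoProg_spec (s := G.inputState l M) hD huniq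
    ⟨rfl, rfl, rfl⟩ ⟨rfl, rfl, rfl, rfl⟩ (fun A hA => by
      obtain ⟨k, rfl⟩ := Nat.exists_eq_add_of_le' hA
      rfl)
  have hrho : ∀ a : G.Copy, 1 - good (G.copyIndex l M a) = G.rho M a := by
    intro a
    have h1 : good (G.copyIndex l M a) = 1 ↔ G.rho M a = 0 :=
      (hg _).trans ((found_iff hl hM a).trans (hM.rho_eq_zero_iff a).symm)
    rcases h01 (G.copyIndex l M a) with h2 | h2
    · rw [h2, rho_eq_one_of_ne_zero fun h => by have := h1.2 h; omega]
    · rw [h2, h1.1 h2]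
  refine ⟨T, s, he, hT.trans ?_, fun x i => ?_, fun y j => ?_⟩
  · change 59 * (G.input l M).sumWeight l.length + 34 * l.length + 6 * (p + q) + _ + _ ≤ _
    rw [hC]
    omega
  · have h1 := copyIndex_lt_off (M := M) hl ⟨.inl x, i⟩
    have h2 := (G.input l M).off_mono (show nodeIndex (.inl x : Fin p ⊕ Fin q) + 1 ≤ p from x.2)
    rw [← off_inl (M := M) hl, ← hrho ⟨.inl x, i⟩]
    exact h4 _ (h1.trans_le h2)
  · have h1 := copyIndex_lt (M := M) hl ⟨.inr y, j⟩
    have h2 : G.copyIndex l M ⟨.inr y, j⟩ = (G.input l M).off p +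
        ((∑ y' ∈ Finset.Iio y, G.numCopies (.inr y')) + j) := by
      rw [← add_assoc, ← off_inr hl]; rfl
    rw [← hrho ⟨.inr y, j⟩, h2]
    exact h5 _ (h2 ▸ h1)

end WBGraph

theorem lemma4p2 :
    (∀ (X : Type*) (Y : Type*) [Fintype X] [Fintype Y] (G : WBGraph X Y)
      (M : Finset (X × Y)), G.IsMaxWeightMatching M → ∀ u : X ⊕ Y,
        ((∑ i : Fin (G.numCopies u), G.rho M ⟨u, i⟩ : ℕ) : ℤ)
          = (G.mwm : ℤ) - ((G.deleteNode u).mwm : ℤ)) ∧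
    (∃ P : RAM.Prog, ∀ κ : ℕ, ∃ C : ℕ,
      ∀ (p q : ℕ) (G : WBGraph (Fin p) (Fin q)) (l : List (Fin p × Fin q))
        (M : Finset (Fin p × Fin q)),
        0 < p + q → G.IsEdgeList l → p + q ≤ κ * l.length → G.IsMaxWeightMatching M →
        ∃ (T : ℕ) (s : RAM.State),
          RAM.Exec (C * G.totalWeight) P (G.inputState l M) T s ∧
          T ≤ C * G.totalWeight ∧ G.HoldsRho M s) :=
  ⟨fun _ _ _ _ _ _ hM u => hM.sum_rho u, RAM.rhoProg, fun κ => ⟨200 + 6 * κ,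
    fun _ _ _ _ _ hn hl hκ hM => WBGraph.exec_rhoProg hl hn hκ hM.1⟩⟩
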